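/- Let $a<0<b$, let $U$ be a real-valued $C^\infty$ function on $[a,b]$, let $\Psi,\Phi,\Upsilon_1,\Upsilon_2$ be real-valued $C^\infty$ functions on $\mathbb{R}$ with supports in $[-1,1]$, and let $\alpha,\beta,\gamma_1,\gamma_2\in\mathbb{R}$. For $\varepsilon\in(0,1)$ put $$\Psi_\varepsilon(x)=\alpha\varepsilon^{-4}\Psi(x/\varepsilon)+\beta\varepsilon^{-3}\Phi(x/\varepsilon)+\gamma_1\varepsilon^{-2}\Upsilon_1(x/\varepsilon)+\gamma_2\varepsilon^{-1}\Upsilon_2(x/\varepsilon),$$ and let $\mathcal{S}_\varepsilon=\frac{d^4}{dx^4}+U(x)+\Psi_\varepsilon(x)$ be the operator in the complex Hilbert space $L_2(a,b)$ with domain $\{f\in W_2^4(a,b): f(a)=f'(a)=f(b)=f'(b)=0\}$. Then the spectrum of $\mathcal{S}_\varepsilon$ is real and discrete: it consists of real eigenvalues of finite multiplicity, which, repeated according to multiplicity, form a nondecreasing sequence $\lambda_1^\varepsilon\le\lambda_2^\varepsilon\le\cdots$ tending to $+\infty$. Moreover: 1. For every $k$, the function $\varepsilon\mapsto\lambda_k^\varepsilon$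 is continuous on $(0,1)$. 2. For every $k$, $\lambda_k^\varepsilon$ is bounded above as $\varepsilon\to0$: there is a constant $C_k$ with $\lambda_k^\varepsilon\le C_k$ for all sufficiently small $\varepsilon>0$. 3. There is a number $r>0$, depending only on $\Psi$, such that if $\Psi$ takes both positive and negative values and $|\alpha|>r$, then there is $c>0$ with $\lambda_1^\varepsilon\le-c\,\varepsilon^{-4}$ for all sufficiently small $\varepsilon>0$; in particular, the spectrum of $\mathcal{S}_\varepsilon$ is unbounded from below as $\varepsilon\to0$, that is, for every real $M$ the spectrum of $\mathcal{S}_\varepsilon$ contains a real number less than $M$ for all sufficiently small $\varepsilon>0$. 4. Only finitely many eigenvalues converge to $-\infty$: the set of indices $k$ such that $\lambda_k^\varepsilon\to-\infty$ as $\varepsilon\to0$ is finite. More precisely, there is $N$ such that for every $k>N$ the eigenvalue $\lambda_k^\varepsilon$ is bounded below as $\varepsilon\to0$. -/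

import Mathlib

open MeasureTheory Filter Topology Set
open scoped ContDiff

/-! ### Eigenvalues and spectrum of unbounded operators -/

section Unbounded

variable {H : Type*} [NormedAddCommGroup H] [InnerProductSpace ℂ H]

/-- The eigenspace `{u ∈ D(T) | T u = z u}` of an unbounded operator `T`. -/
def opEigenspace (T : H →ₗ.[ℂ] H) (z : ℂ) : Submodule ℂ H :=
  T.graph.comap (LinearMap.prod LinearMap.id (z • LinearMap.id))

/-- The resolvent set of an unbounded operator `T`: the numbers `z` for which `T - z` is a
bijection from `D(T)` onto `H` whose inverse `R` is a bounded operator. -/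
def opResolventSet (T : H →ₗ.[ℂ] H) : Set ℂ :=
  {z | ∃ R : H →L[ℂ] H, ∀ u h : H, R h = u ↔ (u, h + z • u) ∈ T.graph}

/-- The spectrum of an unbounded operator. -/
def opSpectrum (T : H →ₗ.[ℂ] H) : Set ℂ := (opResolventSet T)ᶜ

/-- The spectrum of `T` is real and discrete, and `ev 0 ≤ ev 1 ≤ ev 2 ≤ …` are the eigenvalues
of `T`, each one repeated according to its multiplicity. -/
structure EnumeratesEigenvalues (T : H →ₗ.[ℂ] H) (ev : ℕ → ℝ) : Prop where
  monotone : Monotone ev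
  tendsto : Tendsto ev atTop atTop
  spectrum_eq : opSpectrum T = Set.range fun k => (ev k : ℂ)
  finiteDimensional : ∀ z : ℂ, FiniteDimensional ℂ (opEigenspace T z)
  multiplicity : ∀ z : ℂ, Module.finrank ℂ (opEigenspace T z) = {k : ℕ | (ev k : ℂ) = z}.ncard

end Unbounded

/-! ### The Sobolev space `W_2^4(a, b)` and the fourth order operator -/

/-- `F` is absolutely continuous on `[a, b]` with derivative `f` almost everywhere. -/
def IsPrimitiveOn (a b : ℝ) (F f : ℝ → ℂ) : Prop :=
  IntervalIntegrable f volume a b ∧ ∀ x ∈ Icc a b, F x = F a + ∫ t in a..x, f t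

/-- The function `D 0` belongs to `W_2^4(a, b)`, with derivatives `D 1`, `D 2`, `D 3`, `D 4`:
the first three are absolutely continuous on `[a, b]` and the fourth one is in `L_2(a, b)`. -/
structure IsW24 (a b : ℝ) (D : ℕ → ℝ → ℂ) : Prop where
  primitive : ∀ j < 4, IsPrimitiveOn a b (D j) (D (j + 1))
  memLp : MemLp (D 4) 2 (volume.restrict (Ioo a b))

/-- The boundary conditions `f(a) = f'(a) = f(b) = f'(b) = 0`. -/
def IsClamped (a b : ℝ) (D : ℕ → ℝ → ℂ) : Prop :=
  D 0 a = 0 ∧ D 1 a = 0 ∧ D 0 b = 0 ∧ D 1 b = 0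

/-- The complex Hilbert space `L_2(a, b)`. -/
abbrev L2 (a b : ℝ) : Type := Lp ℂ 2 (volume.restrict (Ioo a b))

theorem IsPrimitiveOn.add {a b : ℝ} {F f G g : ℝ → ℂ} (hF : IsPrimitiveOn a b F f)
    (hG : IsPrimitiveOn a b G g) :
    IsPrimitiveOn a b (fun x => F x + G x) (fun x => f x + g x) := by
  refine ⟨hF.1.add hG.1, fun x hx => ?_⟩
  have hsub : uIcc a x ⊆ uIcc a b := by
    rw [uIcc_of_le hx.1, uIcc_of_le (hx.1.trans hx.2)]
    exact Icc_subset_Icc_right hx.2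
  change F x + G x = F a + G a + _
  rw [intervalIntegral.integral_add (hF.1.mono_set hsub) (hG.1.mono_set hsub), hF.2 x hx,
    hG.2 x hx]
  ring

theorem IsPrimitiveOn.const_mul {a b : ℝ} {F f : ℝ → ℂ} (c : ℂ) (hF : IsPrimitiveOn a b F f) :
    IsPrimitiveOn a b (fun x => c * F x) (fun x => c * f x) := by
  refine ⟨hF.1.const_mul c, fun x hx => ?_⟩
  change c * F x = c * F a + _
  rw [intervalIntegral.integral_const_mul, hF.2 x hx]
  ring

theorem IsW24.add {a b : ℝ} {D E : ℕ → ℝ → ℂ} (hD : IsW24 a b D) (hE : IsW24 a b E) :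
    IsW24 a b (fun j x => D j x + E j x) :=
  ⟨fun j hj => (hD.primitive j hj).add (hE.primitive j hj), hD.memLp.add hE.memLp⟩

theorem IsW24.const_mul {a b : ℝ} {D : ℕ → ℝ → ℂ} (c : ℂ) (hD : IsW24 a b D) :
    IsW24 a b (fun j x => c * D j x) :=
  ⟨fun j hj => (hD.primitive j hj).const_mul c, hD.memLp.const_mul c⟩

theorem isW24_zero (a b : ℝ) : IsW24 a b (fun _ _ => 0) :=
  ⟨fun _ _ => ⟨intervalIntegrable_const, fun x _ => by simp⟩, MemLp.zero⟩

/-- The graph `{(f, f'''' + V f)}` of the operator `d^4/dx^4 + V(x)` in `L_2(a, b)` with domain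
`{f ∈ W_2^4(a, b) | f(a) = f'(a) = f(b) = f'(b) = 0}`. -/
def clampedGraph (a b : ℝ) (V : ℝ → ℝ) : Submodule ℂ (L2 a b × L2 a b) where
  carrier := {p | ∃ D : ℕ → ℝ → ℂ, IsW24 a b D ∧ IsClamped a b D ∧
    p.1 =ᵐ[volume.restrict (Ioo a b)] D 0 ∧
    p.2 =ᵐ[volume.restrict (Ioo a b)] fun x => D 4 x + (V x : ℂ) * D 0 x}
  zero_mem' := by
    refine ⟨fun _ _ => 0, isW24_zero a b, ⟨rfl, rfl, rfl, rfl⟩, Lp.coeFn_zero _ _ _, ?_⟩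
    filter_upwards [Lp.coeFn_zero ℂ 2 (volume.restrict (Ioo a b))] with x hx
    simpa using hx
  add_mem' := by
    rintro p q ⟨D, hD, ⟨d1, d2, d3, d4⟩, hp1, hp2⟩ ⟨E, hE, ⟨e1, e2, e3, e4⟩, hq1, hq2⟩
    refine ⟨_, hD.add hE, ⟨?_, ?_, ?_, ?_⟩, ?_, ?_⟩
    · simp [d1, e1]
    · simp [d2, e2]
    · simp [d3, e3]
    · simp [d4, e4]
    · filter_upwards [Lp.coeFn_add p.1 q.1, hp1, hq1] with x hx h1 h2
      rw [Prod.fst_add, hx, Pi.add_apply, h1, h2]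
    · filter_upwards [Lp.coeFn_add p.2 q.2, hp2, hq2] with x hx h1 h2
      rw [Prod.snd_add, hx, Pi.add_apply, h1, h2]
      ring
  smul_mem' := by
    rintro c p ⟨D, hD, ⟨d1, d2, d3, d4⟩, hp1, hp2⟩
    refine ⟨_, hD.const_mul c, ⟨?_, ?_, ?_, ?_⟩, ?_, ?_⟩
    · simp [d1]
    · simp [d2]
    · simp [d3]
    · simp [d4]
    · filter_upwards [Lp.coeFn_smul c p.1, hp1] with x hx h1
      rw [Prod.smul_fst, hx, Pi.smul_apply, h1, smul_eq_mul]
    · filter_upwards [Lp.coeFn_smul c p.2, hp2] with x hx h1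
      rw [Prod.smul_snd, hx, Pi.smul_apply, h1, smul_eq_mul]
      ring

/-- If a primitive vanishes almost everywhere, so does the function it is a primitive of. -/
theorem IsPrimitiveOn.ae_eq_zero {a b : ℝ} {F f : ℝ → ℂ} (h : IsPrimitiveOn a b F f)
    (h0 : F =ᵐ[volume.restrict (Ioo a b)] 0) : f =ᵐ[volume.restrict (Ioo a b)] 0 := by
  rcases le_or_gt b a with hba | hab
  · simp [Ioo_eq_empty (not_lt.mpr hba), Filter.EventuallyEq]
  have hcont : ContinuousOn F (Icc a b) := by
    have h1 : ContinuousOn (fun x => F a + ∫ t in a..x, f t) (Icc a b) := by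
      refine continuousOn_const.add ?_
      have := intervalIntegral.continuousOn_primitive_interval
        (μ := volume) (f := f) (a := a) (b := b) (by
          rw [uIcc_of_le hab.le]
          exact (intervalIntegrable_iff_integrableOn_Icc_of_le hab.le).1 h.1)
      rwa [uIcc_of_le hab.le] at this
    exact h1.congr h.2
  have hzero : EqOn F 0 (Ioo a b) :=
    Measure.eqOn_Ioo_of_ae_eq volume h0 (hcont.mono Ioo_subset_Icc_self) continuousOn_const
  have hd := h.1.ae_hasDerivAt_integral
  rw [Filter.EventuallyEq, ae_restrict_iff' measurableSet_Ioo]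
  filter_upwards [hd] with x hx hxI
  have hxI' : x ∈ uIcc a b := by
    rw [uIcc_of_le hab.le]
    exact Ioo_subset_Icc_self hxI
  have h1 := hx hxI' a left_mem_uIcc
  have h2 : (fun y => ∫ t in a..y, f t) =ᶠ[𝓝 x] fun _ => -F a := by
    filter_upwards [Ioo_mem_nhds hxI.1 hxI.2] with y hy
    have h3 := h.2 y (Ioo_subset_Icc_self hy)
    have h4 : F y = 0 := hzero hy
    rw [h4] at h3
    linear_combination -h3
  exact (h1.congr_of_eventuallyEq h2.symm).unique (hasDerivAt_const x (-F a))

/-- The graph is the graph of an operator. -/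
theorem clampedGraph_functional (a b : ℝ) (V : ℝ → ℝ) (p : L2 a b × L2 a b)
    (hp : p ∈ clampedGraph a b V) (hp1 : p.1 = 0) : p.2 = 0 := by
  obtain ⟨D, hD, -, h1, h2⟩ := hp
  have h0 : D 0 =ᵐ[volume.restrict (Ioo a b)] 0 := by
    rw [hp1] at h1
    exact h1.symm.trans (Lp.coeFn_zero _ _ _)
  have hj : ∀ j ≤ 4, D j =ᵐ[volume.restrict (Ioo a b)] 0 := by
    intro j
    induction j with
    | zero => exact fun _ => h0
    | succ j ih => exact fun hj => (hD.primitive j (by omega)).ae_eq_zero (ih (by omega))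
  rw [Lp.eq_zero_iff_ae_eq_zero]
  filter_upwards [h2, h0, hj 4 le_rfl] with x hx hx0 hx4
  rw [hx, hx0, hx4]
  simp

/-- The operator `d^4/dx^4 + V(x)` in `L_2(a, b)` with domain
`{f ∈ W_2^4(a, b) | f(a) = f'(a) = f(b) = f'(b) = 0}`. -/
noncomputable def clampedOperator (a b : ℝ) (V : ℝ → ℝ) : L2 a b →ₗ.[ℂ] L2 a b :=
  (clampedGraph a b V).toLinearPMap

theorem clampedOperator_graph (a b : ℝ) (V : ℝ → ℝ) :
    (clampedOperator a b V).graph = clampedGraph a b V :=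
  Submodule.toLinearPMap_graph_eq _ (clampedGraph_functional a b V)

/-! ### The singular perturbation -/

/-- A smooth shape: a `C^∞` function supported in `[-1, 1]`. -/
def IsShape (f : ℝ → ℝ) : Prop := ContDiff ℝ ∞ f ∧ tsupport f ⊆ Icc (-1) 1

/-- `f` takes both positive and negative values. -/
def ChangesSign (f : ℝ → ℝ) : Prop := (∃ x, 0 < f x) ∧ ∃ x, f x < 0

/-- The perturbation
`α ε⁻⁴ Ψ(x/ε) + β ε⁻³ Φ(x/ε) + γ₁ ε⁻² Υ₁(x/ε) + γ₂ ε⁻¹ Υ₂(x/ε)`. -/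
noncomputable def singularPotential (α β γ₁ γ₂ : ℝ) (Ψ Φ Υ₁ Υ₂ : ℝ → ℝ) (ε x : ℝ) : ℝ :=
  α / ε ^ 4 * Ψ (x / ε) + β / ε ^ 3 * Φ (x / ε) + γ₁ / ε ^ 2 * Υ₁ (x / ε) + γ₂ / ε * Υ₂ (x / ε)

/-- The operator `S_ε = d^4/dx^4 + U(x) + Ψ_ε(x)` with clamped boundary conditions. -/
noncomputable def singularOperator (a b : ℝ) (U : ℝ → ℝ) (α β γ₁ γ₂ : ℝ) (Ψ Φ Υ₁ Υ₂ : ℝ → ℝ)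
    (ε : ℝ) : L2 a b →ₗ.[ℂ] L2 a b :=
  clampedOperator a b fun x => U x + singularPotential α β γ₁ γ₂ Ψ Φ Υ₁ Υ₂ ε x

/-! ### Compact positive operators -/

section Compact

/-! Two integrations by parts turn `S_ε` into the quadratic form `∫ |f''|² + ∫ (U + Ψ_ε) |f|²`; the
eigenvalues are then compared through the min-max principle.

Spectrum. The clamped problem `D'''' = h` is uniquely solvable, and its solution operator
`clampedInverse` is symmetric, nonnegative and injective. It is compact because, by Poincaré's
inequality on a grid of `m` cells, it has norm `O(m⁻⁴)` on a subspace of finite codimension. A shift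
absorbs the bounded potential (`IsCompactPositive.exists_resolvent`), and the eigenvectors of the
resulting compact positive resolvent yield one sequence that both enumerates the spectrum and
satisfies min-max (`exists_enumeratesEigenvalues_of_resolvent`).

Continuity. By min-max an eigenvalue moves by at most the sup norm of the change in the potential
(`IsMinMax.le_add`).

Upper bounds. Test functions supported in `(b/2, b)` do not meet the perturbation once `ε < b/2`.

Lower bounds. The perturbation is at most `M ε⁻⁴` and lives on `[-ε, ε]`. If `f` and `f'` vanish at
the left ends of `m` equal cells of that interval, Poincaré's inequality gives `∫ |f|² ≤ (2ε/m)⁴ ∫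
|f''|²` there. The powers of `ε` cancel, so a fixed `m` with `16 M ≤ m⁴` lets `∫ |f''|²` absorb the
perturbation. These are `2m` linear conditions, hence at most `2m` eigenvalues can escape to `-∞`.

Ground state. For `f(x) = φ(x/ε)` the form is `ε⁻³ (∫ φ''² + α ∫ Ψ φ²) + O(ε⁻²)`, while `‖f‖² = ε ∫
φ²`. If `φ` is a bump where `α Ψ < 0` and `|α|` is large, the bracket is negative and the first
eigenvalue lies below `-c ε⁻⁴`. -/

theorem IsCompactOperator.tendsto_eigenvalues {H : Type*} [NormedAddCommGroup H]
    [InnerProductSpace ℂ H] {K : H →L[ℂ] H} (hK : IsCompactOperator K)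
    {e : ℕ → H} {μ : ℕ → ℝ} (he : Orthonormal ℂ e) (hpos : ∀ n, 0 < μ n)
    (heig : ∀ n, K (e n) = (μ n : ℂ) • e n) (hanti : Antitone μ) :
    Tendsto μ atTop (𝓝 0) := by
  have hbdd : BddBelow (Set.range μ) := ⟨0, by rintro _ ⟨n, rfl⟩; exact (hpos n).le⟩
  have hlim := tendsto_atTop_ciInf hanti hbdd
  set d := ⨅ i, μ i
  have hd0 : 0 ≤ d := le_ciInf fun n => (hpos n).le
  have hdle : ∀ n, d ≤ μ n := fun n => ciInf_le hbdd n
  rcases hd0.eq_or_lt with h | h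
  · rwa [← h] at hlim
  exfalso
  obtain ⟨C, hC, hC'⟩ := hK.image_closedBall_subset_compact (f := (K : H →ₗ[ℂ] H)) 1
  obtain ⟨y, -, ψ, hψ, hy⟩ := hC.tendsto_subseq (x := fun n => K (e n))
    (fun n => hC' ⟨e n, by simp [he.1 n], rfl⟩)
  have hcs := hy.cauchySeq
  rw [Metric.cauchySeq_iff'] at hcs
  obtain ⟨N, hN⟩ := hcs d h
  have h1 := hN (N + 1) (Nat.le_succ N)
  have hne : ψ (N + 1) ≠ ψ N := (hψ (Nat.lt_succ_self N)).ne'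
  rw [dist_eq_norm] at h1
  -- Pairing with one of the two eigenvectors isolates its eigenvalue, so the terms `K (e n)` are at
  -- mutual distance at least `d` and no subsequence is Cauchy.
  have h2 : (inner ℂ (e (ψ N)) (K (e (ψ (N + 1))) - K (e (ψ N))) : ℂ) = -(μ (ψ N) : ℂ) := by
    rw [heig, heig, inner_sub_right, inner_smul_right, inner_smul_right,
      he.2 hne.symm, inner_self_eq_norm_sq_to_K, he.1]
    simp
  have h3 := norm_inner_le_norm (𝕜 := ℂ) (e (ψ N)) (K (e (ψ (N + 1))) - K (e (ψ N)))
  rw [h2, he.1, one_mul, norm_neg, Complex.norm_real, Real.norm_of_nonneg (hpos _).le] at h3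
  exact absurd (h3.trans_lt h1) (not_lt.2 (hdle _))

variable {H : Type*} [NormedAddCommGroup H] [InnerProductSpace ℂ H] [CompleteSpace H]

/-- A compact, symmetric, nonnegative and injective bounded operator. -/
structure IsCompactPositive {H : Type*} [NormedAddCommGroup H] [InnerProductSpace ℂ H]
    (K : H →L[ℂ] H) : Prop where
  compact : IsCompactOperator K
  symmetric : ∀ x y, inner ℂ (K x) y = inner ℂ x (K y)
  nonneg : ∀ x, 0 ≤ (inner ℂ (K x) x).re
  injective : ∀ x, K x = 0 → x = 0

/-- The spectral radius of a self-adjoint operator is its norm and is attained in the spectrum.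
Compactness makes this nonzero spectral value an eigenvalue, symmetry makes it real, and
nonnegativity fixes its sign. -/
theorem IsCompactPositive.exists_eigenvector_norm [Nontrivial H] {K : H →L[ℂ] H}
    (hK : IsCompactPositive K) : ∃ e : H, ‖e‖ = 1 ∧ K e = ((‖K‖ : ℝ) : ℂ) • e ∧ 0 < ‖K‖ := by
  have hK0 : 0 < ‖K‖ := by
    obtain ⟨x, hx⟩ := exists_ne (0 : H)
    rw [norm_pos_iff]
    rintro rfl
    exact hx (hK.injective x rfl)
  have hsa : IsSelfAdjoint K := LinearMap.IsSymmetric.isSelfAdjoint (A := K) hK.symmetric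
  obtain ⟨z, hz, hzn⟩ := spectrum.exists_nnnorm_eq_spectralRadius K
  rw [ContinuousLinearMap.spectralRadius_eq_nnnorm _ hsa, ENNReal.coe_inj] at hzn
  have hzn' : ‖z‖ = ‖K‖ := congrArg NNReal.toReal hzn
  have hz0 : z ≠ 0 := by
    rw [← norm_pos_iff, hzn']; exact hK0
  have hev := (hK.compact.hasEigenvalue_iff_mem_spectrum hz0).2 hz
  obtain ⟨v, hv⟩ := hev.exists_hasEigenvector
  have hv1 : K v = z • v := hv.apply_eq_smul
  have hv0 : v ≠ 0 := hv.2
  have hvn : (‖v‖ : ℂ) ^ 2 ≠ 0 := by simpa using hv0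
  have hzz : (starRingEnd ℂ) z = z := by
    have := hK.symmetric v v
    rw [hv1, inner_smul_left, inner_smul_right, inner_self_eq_norm_sq_to_K] at this
    exact mul_right_cancel₀ hvn this
  obtain ⟨r, rfl⟩ : ∃ r : ℝ, (r : ℂ) = z := ⟨z.re, Complex.conj_eq_iff_re.1 hzz⟩
  have hr : 0 ≤ r := by
    have h1 := hK.nonneg v
    rw [hv1, inner_smul_left, inner_self_eq_norm_sq_to_K] at h1
    have h2 : ((starRingEnd ℂ) (r : ℂ) * ((‖v‖ : ℝ) : ℂ) ^ 2).re = r * ‖v‖ ^ 2 := by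
      rw [Complex.conj_ofReal]; norm_cast
    have h3 : 0 ≤ r * ‖v‖ ^ 2 := h2 ▸ h1
    exact nonneg_of_mul_nonneg_left h3 (by positivity)
  have hrK : r = ‖K‖ := by
    rw [← hzn', Complex.norm_real, Real.norm_of_nonneg hr]
  refine ⟨((‖v‖⁻¹ : ℝ) : ℂ) • v, ?_, ?_, hK0⟩
  · rw [norm_smul, Complex.norm_real, norm_inv, norm_norm,
      inv_mul_cancel₀ (norm_ne_zero_iff.2 hv0)]
  · rw [map_smul, hv1, ← hrK, smul_comm]

/-- Symmetry makes `Mᗮ` invariant as well, so the previous lemma applies to the restriction of `K`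
to `Mᗮ`; `μ` is the norm of that restriction. -/
theorem IsCompactPositive.exists_eigenvector_orthogonal {K : H →L[ℂ] H}
    (hK : IsCompactPositive K) (hH : ¬ FiniteDimensional ℂ H) (M : Submodule ℂ H)
    [FiniteDimensional ℂ M] (hM : ∀ x ∈ M, K x ∈ M) :
    ∃ (e : H) (μ : ℝ), e ∈ Mᗮ ∧ ‖e‖ = 1 ∧ 0 < μ ∧ K e = (μ : ℂ) • e ∧
      ∀ g ∈ Mᗮ, ‖K g‖ ≤ μ * ‖g‖ := by
  have hinv : ∀ x ∈ Mᗮ, K x ∈ Mᗮ := by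
    intro x hx
    rw [Submodule.mem_orthogonal] at hx ⊢
    intro u hu
    rw [← hK.symmetric]
    exact hx _ (hM u hu)
  have hne : Mᗮ ≠ ⊥ := by
    intro h
    rw [Submodule.orthogonal_eq_bot_iff] at h
    subst h
    exact hH (Submodule.topEquiv (R := ℂ) (M := H)).finiteDimensional
  have : Nontrivial Mᗮ := Submodule.nontrivial_iff_ne_bot.2 hne
  let S : Mᗮ →L[ℂ] Mᗮ := K.restrict hinv
  have hS : IsCompactPositive S := by
    refine ⟨hK.compact.restrict' hinv, fun x y => hK.symmetric x y, fun x => hK.nonneg x, ?_⟩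
    intro x hx
    exact Subtype.ext (hK.injective x (congrArg Subtype.val hx))
  obtain ⟨e, he, hSe, hpos⟩ := hS.exists_eigenvector_norm
  refine ⟨e, ‖S‖, e.2, he, hpos, congrArg Subtype.val hSe, fun g hg => ?_⟩
  exact S.le_opNorm ⟨g, hg⟩

/-- The eigenvectors of a compact positive operator on an infinite dimensional space, ordered by
decreasing eigenvalues. -/
theorem IsCompactPositive.exists_eigenvector_sequence {K : H →L[ℂ] H}
    (hK : IsCompactPositive K) (hH : ¬ FiniteDimensional ℂ H) :
    ∃ (e : ℕ → H) (μ : ℕ → ℝ), Orthonormal ℂ e ∧ (∀ n, 0 < μ n) ∧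
      (∀ n, K (e n) = (μ n : ℂ) • e n) ∧ Antitone μ ∧
      ∀ n g, (∀ m < n, inner ℂ (e m) g = 0) → ‖K g‖ ≤ μ n * ‖g‖ := by
  -- The recursion runs over finite-dimensional invariant subspaces and adjoins one top eigenvector
  -- of the orthogonal complement at a time.
  let X := {M : Submodule ℂ H // FiniteDimensional ℂ M ∧ ∀ x ∈ M, K x ∈ M}
  have step : ∀ M : X, ∃ (e : H) (μ : ℝ), e ∈ (M : Submodule ℂ H)ᗮ ∧ ‖e‖ = 1 ∧ 0 < μ ∧
      K e = (μ : ℂ) • e ∧ ∀ g ∈ (M : Submodule ℂ H)ᗮ, ‖K g‖ ≤ μ * ‖g‖ := by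
    rintro ⟨M, h1, h2⟩
    exact hK.exists_eigenvector_orthogonal hH M h2
  choose nv nm h_mem h_norm h_pos h_eig h_le using step
  have hnext : ∀ M : X, FiniteDimensional ℂ (M.1 ⊔ Submodule.span ℂ {nv M} : Submodule ℂ H) ∧
      ∀ x ∈ M.1 ⊔ Submodule.span ℂ {nv M}, K x ∈ M.1 ⊔ Submodule.span ℂ {nv M} := by
    intro M
    have := M.2.1
    refine ⟨inferInstance, fun x hx => ?_⟩
    obtain ⟨y, hy, z, hz, rfl⟩ := Submodule.mem_sup.1 hx
    obtain ⟨c, rfl⟩ := Submodule.mem_span_singleton.1 hz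
    rw [map_add, map_smul, h_eig]
    exact Submodule.add_mem_sup (M.2.2 y hy) (Submodule.smul_mem _ _
      (Submodule.smul_mem _ _ (Submodule.mem_span_singleton_self _)))
  let S : ℕ → X := fun n => Nat.rec ⟨⊥, inferInstance, fun x hx => by
    rw [Submodule.mem_bot] at hx ⊢; rw [hx, map_zero]⟩ (fun _ M => ⟨_, hnext M⟩) n
  have hS0 : (S 0).1 = ⊥ := rfl
  have hS1 : ∀ n, (S (n + 1)).1 = (S n).1 ⊔ Submodule.span ℂ {nv (S n)} := fun n => rfl
  have hmono : Monotone fun n => (S n).1 :=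
    monotone_nat_of_le_succ fun n => by rw [hS1]; exact le_sup_left
  have hin : ∀ m n, m < n → nv (S m) ∈ (S n).1 := by
    intro m n hmn
    refine hmono (Nat.succ_le_of_lt hmn) ?_
    change _ ∈ (S (m + 1)).1
    rw [hS1]
    exact Submodule.mem_sup_right (Submodule.mem_span_singleton_self _)
  have horth : ∀ n g, (∀ m < n, inner ℂ (nv (S m)) g = 0) → g ∈ (S n).1ᗮ := by
    intro n
    induction n with
    | zero => intro g _; rw [hS0]; simp
    | succ n ih =>
      intro g hg
      rw [hS1, ← Submodule.inf_orthogonal]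
      refine ⟨ih g fun m hm => hg m (hm.trans (Nat.lt_succ_self n)), ?_⟩
      exact Submodule.mem_orthogonal_singleton_iff_inner_right.2 (hg n (Nat.lt_succ_self n))
  have hlt : ∀ m n, m < n → inner ℂ (nv (S m)) (nv (S n)) = 0 := fun m n hmn =>
    (Submodule.mem_orthogonal _ _).1 (h_mem (S n)) _ (hin m n hmn)
  refine ⟨fun n => nv (S n), fun n => nm (S n), ⟨fun n => h_norm _, ?_⟩, fun n => h_pos _,
    fun n => h_eig _, ?_, fun n g hg => h_le _ _ (horth n g hg)⟩
  · intro m n hmn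
    rcases lt_or_gt_of_ne hmn with h | h
    · exact hlt m n h
    · exact inner_eq_zero_symm.1 (hlt n m h)
  · refine antitone_nat_of_succ_le fun n => ?_
    -- The next eigenvector is still orthogonal to the smaller subspace, so the earlier norm bound
    -- applies to it.
    have h1 := h_le (S n) (nv (S (n + 1)))
      (Submodule.orthogonal_le (hmono (Nat.le_succ n)) (h_mem _))
    rw [h_eig, norm_smul, h_norm, Complex.norm_real, Real.norm_of_nonneg (h_pos _).le] at h1
    simpa using h1

end Compact

/-! ### The min-max principle -/

section MinMax

variable {H : Type*} [NormedAddCommGroup H] [InnerProductSpace ℂ H]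

/-- The numbers `ev k` are given by the min-max formula for the operator with graph `Γ`. -/
structure IsMinMax (Γ : Submodule ℂ (H × H)) (ev : ℕ → ℝ) : Prop where
  exists_le : ∀ k, ∃ E ≤ Γ, Module.finrank ℂ E = k + 1 ∧
    ∀ p ∈ E, (inner ℂ p.2 p.1).re ≤ ev k * ‖p.1‖ ^ 2
  exists_ge : ∀ k, ∀ E ≤ Γ, Module.finrank ℂ E = k + 1 →
    ∃ p ∈ E, p ≠ 0 ∧ ev k * ‖p.1‖ ^ 2 ≤ (inner ℂ p.2 p.1).re

/-- Positivity of `K` at `g - t u` gives `⟨g, u⟩ ≥ (2t - t² μ) ‖u‖²`, and `t = 1/μ` is the best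
choice. This is the lower half of min-max: it bounds the form of `K⁻¹` from below. -/
theorem inner_re_ge_of_norm_le {K : H →L[ℂ] H} (hK : IsCompactPositive K) {g u : H} {μ : ℝ}
    (hμ : 0 < μ) (hu : K g = u) (hle : ‖K u‖ ≤ μ * ‖u‖) : ‖u‖ ^ 2 / μ ≤ (inner ℂ g u).re := by
  set t : ℝ := 1 / μ
  have h1 := hK.nonneg (g - (t : ℂ) • u)
  have h2 : (inner ℂ (K u) u).re ≤ μ * ‖u‖ ^ 2 := by
    calc (inner ℂ (K u) u).re ≤ ‖inner ℂ (K u) u‖ := Complex.re_le_norm _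
      _ ≤ ‖K u‖ * ‖u‖ := norm_inner_le_norm _ _
      _ ≤ μ * ‖u‖ * ‖u‖ := by gcongr
      _ = μ * ‖u‖ ^ 2 := by ring
  have huu : (inner ℂ u u : ℂ).re = ‖u‖ ^ 2 := inner_self_eq_norm_sq (𝕜 := ℂ) u
  have h3 : (inner ℂ (K (g - (t : ℂ) • u)) (g - (t : ℂ) • u)).re =
      (inner ℂ g u).re - 2 * t * ‖u‖ ^ 2 + t ^ 2 * (inner ℂ (K u) u).re := by
    have h5 : (inner ℂ u g : ℂ).re = (inner ℂ g u).re := by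
      rw [← inner_conj_symm, Complex.conj_re]
    have h6 : (inner ℂ (K u) g : ℂ) = inner ℂ u u := by rw [hK.symmetric, hu]
    rw [map_sub, map_smul, hu, inner_sub_left, inner_sub_right, inner_sub_right,
      inner_smul_left, inner_smul_right, inner_smul_left, inner_smul_right, Complex.conj_ofReal,
      h6]
    simp only [Complex.sub_re, Complex.re_ofReal_mul, h5, huu]
    ring
  rw [h3] at h1
  have h4 : t ^ 2 * (inner ℂ (K u) u).re ≤ t ^ 2 * (μ * ‖u‖ ^ 2) := by gcongr
  have h5 : t ^ 2 * (μ * ‖u‖ ^ 2) = t * ‖u‖ ^ 2 := by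
    simp only [t]; field_simp
  have h6 : ‖u‖ ^ 2 / μ = t * ‖u‖ ^ 2 := by simp only [t]; ring
  rw [h6]; linarith

variable [CompleteSpace H]

/-- The spectral theorem for an operator with compact positive resolvent at a real point. -/
theorem exists_enumeratesEigenvalues_of_resolvent (hH : ¬ FiniteDimensional ℂ H)
    {T : H →ₗ.[ℂ] H} {K : H →L[ℂ] H} (hK : IsCompactPositive K) {c : ℝ}
    (hT : ∀ u f, (u, f) ∈ T.graph ↔ K (f + (c : ℂ) • u) = u) :
    ∃ ev : ℕ → ℝ, EnumeratesEigenvalues T ev ∧ IsMinMax T.graph ev := by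
  obtain ⟨e, μ, he, hpos, heig, hanti, hle⟩ := hK.exists_eigenvector_sequence hH
  have hlim := hK.compact.tendsto_eigenvalues he hpos heig hanti
  -- A vector orthogonal to every `e n` satisfies `‖K g‖ ≤ μ n ‖g‖` for all `n`, and `μ n → 0`.
  have hcomplete : ∀ g, (∀ n, inner ℂ (e n) g = 0) → g = 0 := by
    intro g hg
    have h1 : ‖K g‖ ≤ 0 * ‖g‖ :=
      ge_of_tendsto' (hlim.mul_const _) fun n => hle n g fun m _ => hg m
    rw [zero_mul, norm_le_zero_iff] at h1
    exact hK.injective g h1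
  have hcoef : ∀ n g, inner ℂ (e n) (K g) = (μ n : ℂ) * inner ℂ (e n) g := by
    intro n g
    rw [← hK.symmetric, heig, inner_smul_left, Complex.conj_ofReal]
  have hμ0 : ∀ n, (μ n : ℂ) ≠ 0 := fun n => by exact_mod_cast (hpos n).ne'
  -- The hypothesis says that `T = K⁻¹ - c`.
  set ev : ℕ → ℝ := fun k => 1 / μ k - c
  have hgr : ∀ k, (e k, (ev k : ℂ) • e k) ∈ T.graph := by
    intro k
    rw [hT, ← add_smul, map_smul, heig, smul_smul]
    have : ((ev k : ℂ) + c) * μ k = 1 := by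
      simp only [ev]; push_cast; field_simp [hμ0 k]; ring
    rw [this, one_smul]
  have hmono : Monotone ev := fun m n hmn =>
    sub_le_sub_right (one_div_le_one_div_of_le (hpos n) (hanti hmn)) _
  have htend : Tendsto ev atTop atTop := by
    refine tendsto_atTop_add_const_right _ (-c) ?_
    simp only [one_div]
    exact tendsto_inv_nhdsGT_zero.comp
      (tendsto_nhdsWithin_iff.2 ⟨hlim, Eventually.of_forall hpos⟩)
  have hmem : ∀ (z : ℂ) (u : H), (u, z • u) ∈ T.graph ↔ (z + c) • K u = u := by
    intro z u
    rw [hT, ← add_smul, map_smul]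
  have hcoef0 : ∀ (z : ℂ) (u : H), (u, z • u) ∈ T.graph → ∀ k, (ev k : ℂ) ≠ z → inner ℂ (e k) u = 0 := by
    intro z u hu k hk
    rw [hmem] at hu
    have h1 : (z + c) * ((μ k : ℂ) * inner ℂ (e k) u) = inner ℂ (e k) u := by
      rw [← hcoef, ← inner_smul_right, hu]
    by_contra h0
    apply hk
    have h2 : (z + c) * (μ k : ℂ) = 1 := by
      apply mul_right_cancel₀ h0
      rw [one_mul, mul_assoc, h1]
    have h3 : z + c = 1 / (μ k : ℂ) := by rw [eq_div_iff (hμ0 k), h2]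
    simp only [ev]; push_cast; rw [← h3]; ring
  have hfin : ∀ z : ℂ, {k : ℕ | (ev k : ℂ) = z}.Finite := by
    intro z
    have h1 : ∀ᶠ k in atTop, z.re < ev k := htend.eventually_gt_atTop _
    obtain ⟨N, hN⟩ := eventually_atTop.1 h1
    refine (Set.finite_lt_nat N).subset fun k hk => ?_
    by_contra hkN
    have h2 := hN k (not_lt.1 hkN)
    rw [← (show (ev k : ℂ) = z from hk), Complex.ofReal_re] at h2
    exact lt_irrefl _ h2
  have hspace : ∀ z : ℂ, opEigenspace T z = Submodule.span ℂ (e '' {k : ℕ | (ev k : ℂ) = z}) := by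
    intro z
    apply le_antisymm
    · intro u hu
      have hu' : (u, z • u) ∈ T.graph := hu
      have h1 : u = ∑ k ∈ (hfin z).toFinset, (inner ℂ (e k) u : ℂ) • e k := by
        rw [← sub_eq_zero]
        apply hcomplete
        intro n
        rw [inner_sub_right, sub_eq_zero]
        by_cases hn : (ev n : ℂ) = z
        · rw [he.inner_right_sum (fun k => inner ℂ (e k) u) (by simpa using hn)]
        · rw [hcoef0 z u hu' n hn, inner_sum]
          refine (Finset.sum_eq_zero fun k hk => ?_).symm
          have hkz : (ev k : ℂ) = z := by simpa using hk
          rw [inner_smul_right, he.2 (by rintro rfl; exact hn hkz), mul_zero]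
      rw [h1]
      refine Submodule.sum_mem _ fun k hk => Submodule.smul_mem _ _ (Submodule.subset_span ?_)
      exact ⟨k, by simpa using hk, rfl⟩
    · rw [Submodule.span_le]
      rintro _ ⟨k, rfl, rfl⟩
      exact hgr k
  refine ⟨ev, ⟨hmono, htend, ?_, ?_, ?_⟩, ?_, ?_⟩
  · ext z
    rw [opSpectrum, Set.mem_compl_iff, not_iff_comm]
    constructor
    · intro hz
      have hz' : ∀ k, (ev k : ℂ) ≠ z := fun k hk => hz ⟨k, hk⟩
      -- The resolvent at `z` will be `(1 - (z + c) K)⁻¹ K`. By compactness, the inverse can only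
      -- fail to exist if `(z + c)⁻¹` is an eigenvalue of `K`; its eigenvector would be orthogonal
      -- to every `e k`.
      have hunit : IsUnit (1 - (z + c) • K) := by
        by_cases hzc : z + c = 0
        · simp [hzc]
        have h1 : (z + c)⁻¹ ∉ spectrum ℂ K := by
          rw [← hK.compact.hasEigenvalue_iff_mem_spectrum (inv_ne_zero hzc)]
          intro h2
          obtain ⟨v, hv⟩ := h2.exists_hasEigenvector
          have hv1 : K v = (z + c)⁻¹ • v := hv.apply_eq_smul
          apply hv.2
          refine hcomplete v fun k => hcoef0 z v ?_ k (hz' k)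
          rw [hmem, hv1, smul_inv_smul₀ hzc]
        rw [spectrum.notMem_iff] at h1
        have h2 : (1 - (z + c) • K) = (Units.mk0 _ hzc) • (algebraMap ℂ (H →L[ℂ] H) (z + c)⁻¹ - K) := by
          rw [Units.smul_mk0, smul_sub, Algebra.algebraMap_eq_smul_one, smul_inv_smul₀ hzc]
        rw [h2]
        exact h1.smul _
      obtain ⟨A, hA⟩ := hunit
      have hA1 : ∀ x, (A : H →L[ℂ] H) ((↑A⁻¹ : H →L[ℂ] H) x) = x := fun x =>
        DFunLike.congr_fun A.mul_inv x
      have hA2 : ∀ x, (↑A⁻¹ : H →L[ℂ] H) ((A : H →L[ℂ] H) x) = x := fun x =>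
        DFunLike.congr_fun A.inv_mul x
      refine ⟨(↑A⁻¹ : H →L[ℂ] H) ∘L K, fun u h => ?_⟩
      have h3 : (u, h + z • u) ∈ T.graph ↔ K h = (A : H →L[ℂ] H) u := by
        rw [hT, add_assoc, ← add_smul, map_add, map_smul, hA]
        exact eq_sub_iff_add_eq.symm
      rw [h3, ContinuousLinearMap.comp_apply]
      constructor
      · intro h4; rw [← h4, hA1]
      · intro h4; rw [h4, hA2]
    · rintro ⟨R, hR⟩ ⟨k, rfl⟩
      have h1 : R 0 = e k := by
        rw [hR, zero_add]; exact hgr k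
      rw [map_zero] at h1
      have := he.1 k
      rw [← h1, norm_zero] at this
      exact zero_ne_one this
  · intro z
    rw [hspace]
    exact FiniteDimensional.span_of_finite ℂ ((hfin z).image _)
  · intro z
    have h1 : LinearIndependent ℂ (fun k : {k : ℕ | (ev k : ℂ) = z} => e k) :=
      he.linearIndependent.comp _ Subtype.val_injective
    have := (hfin z).fintype
    have h2 := finrank_span_eq_card h1
    rw [hspace, Set.image_eq_range, h2, ← Nat.card_eq_fintype_card, Nat.card_coe_set_eq]
  · intro k
    set v : Fin (k + 1) → H × H := fun i => (e i, (ev i : ℂ) • e i)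
    have hv : LinearIndependent ℂ v := by
      apply LinearIndependent.of_comp (LinearMap.fst ℂ H H)
      exact he.linearIndependent.comp (fun i : Fin (k + 1) => (i : ℕ)) Fin.val_injective
    refine ⟨Submodule.span ℂ (Set.range v), ?_, ?_, ?_⟩
    · rw [Submodule.span_le]
      rintro _ ⟨i, rfl⟩
      exact hgr i
    · rw [finrank_span_eq_card hv, Fintype.card_fin]
    · intro p hp
      obtain ⟨a, rfl⟩ := (Submodule.mem_span_range_iff_exists_fun ℂ).1 hp
      have ho : Orthonormal ℂ (fun i : Fin (k + 1) => e i) := he.comp _ Fin.val_injective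
      have h1 : (∑ i, a i • v i).1 = ∑ i, a i • e i := by
        rw [Prod.fst_sum]; rfl
      have h2 : (∑ i, a i • v i).2 = ∑ i, (a i * (ev i : ℂ)) • e i := by
        rw [Prod.snd_sum]
        exact Finset.sum_congr rfl fun i _ => smul_smul _ _ _
      have h3 : ‖∑ i, a i • e i‖ ^ 2 = ∑ i, ‖a i‖ ^ 2 := by
        rw [← inner_self_eq_norm_sq (𝕜 := ℂ), ho.inner_sum]
        simp [← Complex.normSq_eq_norm_sq, ← Complex.normSq_eq_conj_mul_self]
      have h4 : (inner ℂ (∑ i, (a i * (ev i : ℂ)) • e i) (∑ i, a i • e i)).re =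
          ∑ i : Fin (k + 1), ev i * ‖a i‖ ^ 2 := by
        rw [ho.inner_sum, Complex.re_sum]
        refine Finset.sum_congr rfl fun i _ => ?_
        rw [map_mul, Complex.conj_ofReal, mul_right_comm, ← Complex.normSq_eq_conj_mul_self,
          Complex.normSq_eq_norm_sq, ← Complex.ofReal_mul, Complex.ofReal_re, mul_comm]
      rw [h1, h2, h3, h4, Finset.mul_sum]
      gcongr with i
      exact hmono (Nat.lt_succ_iff.1 i.2)
  · intro k E hE hEk
    have : FiniteDimensional ℂ E := Module.finite_of_finrank_pos (by omega)
    -- Orthogonality to `e 0, …, e (k - 1)` is `k` conditions on a space of dimension `k + 1`, so a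
    -- nonzero solution exists.
    let L : E →ₗ[ℂ] (Fin k → ℂ) := LinearMap.pi fun i =>
      (innerₛₗ ℂ (e i)).comp ((LinearMap.fst ℂ H H).comp E.subtype)
    have hL : LinearMap.ker L ≠ ⊥ := by
      apply LinearMap.ker_ne_bot_of_finrank_lt
      rw [hEk, Module.finrank_fin_fun]
      exact Nat.lt_succ_self k
    obtain ⟨p, hp, hp0⟩ := Submodule.exists_mem_ne_zero_of_ne_bot hL
    have hpe : ∀ m < k, inner ℂ (e m) p.1.1 = 0 := fun m hm =>
      congrFun (LinearMap.mem_ker.1 hp) ⟨m, hm⟩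
    refine ⟨p.1, p.2, fun h => hp0 (Subtype.ext h), ?_⟩
    have h1 := (hT p.1.1 p.1.2).1 (hE p.2)
    have h2 := inner_re_ge_of_norm_le hK (hpos k) h1 (hle k _ hpe)
    rw [inner_add_left, inner_smul_left, Complex.conj_ofReal, Complex.add_re,
      Complex.re_ofReal_mul] at h2
    have h3 : (inner ℂ p.1.1 p.1.1 : ℂ).re = ‖p.1.1‖ ^ 2 := inner_self_eq_norm_sq (𝕜 := ℂ) _
    rw [h3] at h2
    have h4 : ev k * ‖p.1.1‖ ^ 2 = ‖p.1.1‖ ^ 2 / μ k - c * ‖p.1.1‖ ^ 2 := by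
      simp only [ev]; ring
    rw [h4]; linarith

/-- A bounded symmetric perturbation `G⁻¹ + V` of the inverse of a compact positive operator has
a compact positive resolvent. -/
theorem IsCompactPositive.exists_resolvent {G V : H →L[ℂ] H} (hG : IsCompactPositive G)
    (hV : ∀ x y, inner ℂ (V x) y = inner ℂ x (V y)) :
    ∃ (K : H →L[ℂ] H) (c : ℝ), IsCompactPositive K ∧
      ∀ u f, G (f - V u) = u ↔ K (f + (c : ℂ) • u) = u := by
  -- This shift makes `W = V + c` at least the identity. The resolvent is then `K = (1 + G W)⁻¹ G`.
  set c : ℝ := ‖V‖ + 1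
  set W : H →L[ℂ] H := V + (c : ℂ) • 1
  have hWa : ∀ x, W x = V x + (c : ℂ) • x := fun x => rfl
  have hWs : ∀ x y, inner ℂ (W x) y = inner ℂ x (W y) := by
    intro x y
    rw [hWa, hWa, inner_add_left, inner_add_right, hV, inner_smul_left, inner_smul_right,
      Complex.conj_ofReal]
  have hW1 : ∀ x, ‖x‖ ^ 2 ≤ (inner ℂ (W x) x).re := by
    intro x
    have h1 : (inner ℂ x x : ℂ).re = ‖x‖ ^ 2 := inner_self_eq_norm_sq (𝕜 := ℂ) _
    rw [hWa, inner_add_left, inner_smul_left, Complex.conj_ofReal, Complex.add_re,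
      Complex.re_ofReal_mul, h1]
    have h2 : -(‖V‖ * ‖x‖ ^ 2) ≤ (inner ℂ (V x) x).re := by
      have h3 : ‖inner ℂ (V x) x‖ ≤ ‖V‖ * ‖x‖ ^ 2 := by
        calc ‖inner ℂ (V x) x‖ ≤ ‖V x‖ * ‖x‖ := norm_inner_le_norm _ _
          _ ≤ ‖V‖ * ‖x‖ * ‖x‖ := by gcongr; exact V.le_opNorm x
          _ = _ := by ring
      have h4 := Complex.abs_re_le_norm (inner ℂ (V x) x)
      linarith [neg_abs_le (inner ℂ (V x) x).re]
    simp only [c]; linarith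
  have hcomp : IsCompactOperator (G ∘L W) := hG.compact.comp_clm W
  -- By compactness only an eigenvalue `-1` of `G W` could obstruct. If `G W v = -v`, then `⟨G W v,
  -- W v⟩ = -⟨v, W v⟩` has real part at most `-‖v‖²`, against the nonnegativity of `G`.
  have hunit : IsUnit (1 + G ∘L W) := by
    have h1 : (-1 : ℂ) ∉ spectrum ℂ (G ∘L W) := by
      rw [← hcomp.hasEigenvalue_iff_mem_spectrum (by norm_num)]
      intro h2
      obtain ⟨v, hv⟩ := h2.exists_hasEigenvector
      have hv1 : G (W v) = (-1 : ℂ) • v := hv.apply_eq_smul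
      apply hv.2
      have h3 := hG.nonneg (W v)
      rw [hv1, inner_smul_left, ← inner_conj_symm, ← map_mul, Complex.conj_re, neg_one_mul,
        Complex.neg_re] at h3
      have h4 := hW1 v
      have h5 : ‖v‖ ^ 2 = 0 := le_antisymm (by linarith) (by positivity)
      simpa using h5
    rw [spectrum.notMem_iff] at h1
    have h2 : (1 + G ∘L W) = -(algebraMap ℂ (H →L[ℂ] H) (-1) - G ∘L W) := by
      rw [map_neg, map_one]; abel
    rw [h2]
    exact h1.neg
  obtain ⟨A, hA⟩ := hunit
  have hA1 : ∀ x, (A : H →L[ℂ] H) ((↑A⁻¹ : H →L[ℂ] H) x) = x := fun x =>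
    DFunLike.congr_fun A.mul_inv x
  have hA2 : ∀ x, (↑A⁻¹ : H →L[ℂ] H) ((A : H →L[ℂ] H) x) = x := fun x =>
    DFunLike.congr_fun A.inv_mul x
  set K : H →L[ℂ] H := (↑A⁻¹ : H →L[ℂ] H) ∘L G
  have hKG : ∀ u h, K h = u ↔ G (h - W u) = u := by
    intro u h
    have h1 : G (h - W u) = u ↔ G h = (A : H →L[ℂ] H) u := by
      rw [hA, map_sub, sub_eq_iff_eq_add]; rfl
    rw [h1]
    constructor
    · intro h4; rw [← h4]; exact (hA1 _).symm
    · intro h4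
      change (↑A⁻¹ : H →L[ℂ] H) (G h) = u
      rw [h4, hA2]
  refine ⟨K, c, ⟨hG.compact.clm_comp _, ?_, ?_, ?_⟩, ?_⟩
  · intro x y
    have h1 := (hKG (K x) x).1 rfl
    have h2 := (hKG (K y) y).1 rfl
    have h3 : inner ℂ (K x) y = inner ℂ (K x) (y - W (K y)) + inner ℂ (K x) (W (K y)) := by
      rw [← inner_add_right, sub_add_cancel]
    have h4 : inner ℂ x (K y) = inner ℂ (x - W (K x)) (K y) + inner ℂ (W (K x)) (K y) := by
      rw [← inner_add_left, sub_add_cancel]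
    have h5 : (inner ℂ (K x) (y - W (K y)) : ℂ) = inner ℂ (x - W (K x)) (K y) := by
      have := hG.symmetric (x - W (K x)) (y - W (K y))
      rwa [h1, h2] at this
    rw [h3, h4, hWs, h5]
  · intro x
    have h1 := (hKG (K x) x).1 rfl
    have h3 : inner ℂ (K x) x = inner ℂ (K x) (x - W (K x)) + inner ℂ (K x) (W (K x)) := by
      rw [← inner_add_right, sub_add_cancel]
    have h4 := hG.nonneg (x - W (K x))
    rw [h1] at h4
    have h5 := hW1 (K x)
    rw [h3, Complex.add_re, ← hWs]
    have : 0 ≤ ‖K x‖ ^ 2 := by positivity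
    linarith
  · intro x hx
    have h1 := (hKG 0 x).1 hx
    rw [map_zero, sub_zero] at h1
    exact hG.injective x h1
  · intro u f
    rw [hKG]
    have : f + (c : ℂ) • u - W u = f - V u := by rw [hWa]; abel
    rw [this]

end MinMax

/-! ### Absolutely continuous functions and the Poincaré inequality -/

section Primitive

variable {a b : ℝ} {F f G g : ℝ → ℂ}

theorem IsPrimitiveOn.continuousOn (hab : a ≤ b) (h : IsPrimitiveOn a b F f) :
    ContinuousOn F (Icc a b) := by
  have h1 : ContinuousOn (fun x => F a + ∫ t in a..x, f t) (Icc a b) := by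
    refine continuousOn_const.add ?_
    have := intervalIntegral.continuousOn_primitive_interval
      (μ := volume) (f := f) (a := a) (b := b) (by
        rw [uIcc_of_le hab]
        exact (intervalIntegrable_iff_integrableOn_Icc_of_le hab).1 h.1)
    rwa [uIcc_of_le hab] at this
  exact h1.congr h.2

theorem IsPrimitiveOn.integral_eq_sub (h : IsPrimitiveOn a b F f) {x y : ℝ}
    (hx : x ∈ Icc a b) (hy : y ∈ Icc a b) : ∫ t in x..y, f t = F y - F x := by
  have hab : a ≤ b := hx.1.trans hx.2
  have hi : ∀ z ∈ Icc a b, IntervalIntegrable f volume a z := fun z hz =>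
    h.1.mono_set (by
      rw [uIcc_of_le hz.1, uIcc_of_le hab]
      exact Icc_subset_Icc_right hz.2)
  rw [← intervalIntegral.integral_interval_sub_left (hi y hy) (hi x hx), h.2 y hy, h.2 x hx]
  ring

theorem IsPrimitiveOn.conj (h : IsPrimitiveOn a b F f) :
    IsPrimitiveOn a b (fun x => (starRingEnd ℂ) (F x)) (fun x => (starRingEnd ℂ) (f x)) := by
  constructor
  · have h1 := h.1
    rw [intervalIntegrable_iff] at h1 ⊢
    exact Complex.conjLIE.toContinuousLinearEquiv.toContinuousLinearMap.integrable_comp h1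
  · intro x hx
    change (starRingEnd ℂ) (F x) = (starRingEnd ℂ) (F a) + _
    rw [h.2 x hx, map_add]
    congr 1
    simp only [intervalIntegral]
    rw [map_sub, integral_conj, integral_conj]

theorem isPrimitiveOn_integral (hf : IntervalIntegrable f volume a b) :
    IsPrimitiveOn a b (fun x => ∫ t in a..x, f t) f :=
  ⟨hf, fun x _ => by simp⟩

theorem isPrimitiveOn_of_hasDerivAt (h : ∀ x, HasDerivAt F (f x) x)
    (hf : Continuous f) : IsPrimitiveOn a b F f := by
  refine ⟨hf.intervalIntegrable _ _, fun x _ => ?_⟩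
  rw [intervalIntegral.integral_eq_sub_of_hasDerivAt (fun y _ => h y) (hf.intervalIntegrable _ _)]
  ring

/-- Integration by parts for absolutely continuous functions, by Fubini for `f t * g x` on the
triangle `t ≤ x`: one order of integration produces `G b - G t`, the other `F x - F a`. -/
theorem IsPrimitiveOn.integral_mul_add (hab : a ≤ b) (hF : IsPrimitiveOn a b F f)
    (hG : IsPrimitiveOn a b G g) :
    (∫ x in a..b, f x * G x) + ∫ x in a..b, F x * g x = F b * G b - F a * G a := by
  have ha : a ∈ Icc a b := left_mem_Icc.2 hab
  have hb : b ∈ Icc a b := right_mem_Icc.2 hab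
  have hFc := hF.continuousOn hab
  have hGc := hG.continuousOn hab
  set μ := volume.restrict (Ioc a b) with hμ
  have hfi : Integrable f μ := (intervalIntegrable_iff_integrableOn_Ioc_of_le hab).1 hF.1
  have hgi : Integrable g μ := (intervalIntegrable_iff_integrableOn_Ioc_of_le hab).1 hG.1
  have hS : MeasurableSet {p : ℝ × ℝ | p.1 ≤ p.2} := measurableSet_le measurable_fst measurable_snd
  have hprod : Integrable (Function.uncurry fun t x =>
      {p : ℝ × ℝ | p.1 ≤ p.2}.indicator (fun p => f p.1 * g p.2) (t, x)) (μ.prod μ) :=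
    (hfi.mul_prod hgi).indicator hS
  have hswap := integral_integral_swap hprod
  have hleft : ∀ t ∈ Ioc a b,
      (∫ x, {p : ℝ × ℝ | p.1 ≤ p.2}.indicator (fun p => f p.1 * g p.2) (t, x) ∂μ) =
        f t * (G b - G t) := by
    intro t ht
    have h1 : (fun x => {p : ℝ × ℝ | p.1 ≤ p.2}.indicator (fun p => f p.1 * g p.2) (t, x)) =
        (Ici t).indicator fun x => f t * g x := by
      ext x; simp [Set.indicator]
    rw [h1, integral_indicator measurableSet_Ici, hμ, Measure.restrict_restrict measurableSet_Ici,
      integral_const_mul]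
    congr 1
    have h2 : Ici t ∩ Ioc a b = Icc t b := by
      ext x; simp only [mem_inter_iff, mem_Ici, mem_Ioc, mem_Icc]
      exact ⟨fun h => ⟨h.1, h.2.2⟩, fun h => ⟨h.1, ht.1.trans_le h.1, h.2⟩⟩
    rw [h2, integral_Icc_eq_integral_Ioc, ← intervalIntegral.integral_of_le ht.2,
      hG.integral_eq_sub (Ioc_subset_Icc_self ht) hb]
  have hright : ∀ x ∈ Ioc a b,
      (∫ t, {p : ℝ × ℝ | p.1 ≤ p.2}.indicator (fun p => f p.1 * g p.2) (t, x) ∂μ) =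
        (F x - F a) * g x := by
    intro x hx
    have h1 : (fun t => {p : ℝ × ℝ | p.1 ≤ p.2}.indicator (fun p => f p.1 * g p.2) (t, x)) =
        (Iic x).indicator fun t => f t * g x := by
      ext t; simp [Set.indicator]
    rw [h1, integral_indicator measurableSet_Iic, hμ, Measure.restrict_restrict measurableSet_Iic,
      integral_mul_const]
    congr 1
    have h2 : Iic x ∩ Ioc a b = Ioc a x := by
      ext t; simp only [mem_inter_iff, mem_Iic, mem_Ioc]
      exact ⟨fun h => ⟨h.2.1, h.1⟩, fun h => ⟨h.2, h.1, h.2.trans hx.2⟩⟩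
    rw [h2, ← intervalIntegral.integral_of_le hx.1.le,
      hF.integral_eq_sub ha (Ioc_subset_Icc_self hx)]
  have hkey : ∫ t in a..b, f t * (G b - G t) = ∫ x in a..b, (F x - F a) * g x := by
    rw [intervalIntegral.integral_of_le hab, intervalIntegral.integral_of_le hab,
      ← setIntegral_congr_fun measurableSet_Ioc hleft,
      ← setIntegral_congr_fun measurableSet_Ioc hright]
    exact hswap
  have hfG : IntervalIntegrable (fun x => f x * G x) volume a b :=
    hF.1.mul_continuousOn (by rwa [uIcc_of_le hab])
  have hFg : IntervalIntegrable (fun x => F x * g x) volume a b :=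
    hG.1.continuousOn_mul (by rwa [uIcc_of_le hab])
  simp only [mul_sub, sub_mul] at hkey
  rw [intervalIntegral.integral_sub (hF.1.mul_const _) hfG,
    intervalIntegral.integral_sub hFg (hG.1.const_mul _), intervalIntegral.integral_mul_const,
    intervalIntegral.integral_const_mul, hF.integral_eq_sub ha hb, hG.integral_eq_sub ha hb] at hkey
  linear_combination -hkey

/-- Cauchy–Schwarz against the constant `1`, obtained from `∫ (φ - m)² ≥ 0` with `m` the mean of
`φ`. -/
theorem sq_integral_le {φ : ℝ → ℝ} {p q : ℝ} (hpq : p ≤ q) (hφ : ContinuousOn φ (Icc p q)) :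
    (∫ x in p..q, φ x) ^ 2 ≤ (q - p) * ∫ x in p..q, φ x ^ 2 := by
  rcases hpq.eq_or_lt with rfl | hlt
  · simp
  have hL : 0 < q - p := sub_pos.2 hlt
  have hφ' : ContinuousOn φ (uIcc p q) := by rwa [uIcc_of_le hpq]
  set S := ∫ x in p..q, φ x
  set m := S / (q - p)
  have h1 : 0 ≤ ∫ x in p..q, (φ x - m) ^ 2 :=
    intervalIntegral.integral_nonneg hpq fun x _ => sq_nonneg _
  have h2 : ∫ x in p..q, (φ x - m) ^ 2 = (∫ x in p..q, φ x ^ 2) - 2 * m * S + (q - p) * m ^ 2 := by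
    have h3 : ∀ x, (φ x - m) ^ 2 = φ x ^ 2 - 2 * m * φ x + m ^ 2 := fun x => by ring
    simp only [h3]
    rw [intervalIntegral.integral_add, intervalIntegral.integral_sub,
      intervalIntegral.integral_const_mul, intervalIntegral.integral_const, smul_eq_mul]
    · exact (hφ'.pow 2).intervalIntegrable
    · exact (continuousOn_const.mul hφ').intervalIntegrable
    · exact ((hφ'.pow 2).sub (continuousOn_const.mul hφ')).intervalIntegrable
    · exact intervalIntegrable_const
  rw [h2] at h1
  have h4 : S = m * (q - p) := by simp only [m]; field_simp
  have h5 : 0 ≤ (q - p) * ((∫ x in p..q, φ x ^ 2) - 2 * m * S + (q - p) * m ^ 2) :=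
    mul_nonneg hL.le h1
  have h6 : S ^ 2 = 2 * m * S * (q - p) - (q - p) ^ 2 * m ^ 2 := by rw [h4]; ring
  rw [h6]
  linarith

variable {F₀ F₁ F₂ : ℝ → ℂ}

theorem IsPrimitiveOn.norm_sq_le (h : IsPrimitiveOn a b F f) (hf : ContinuousOn f (Icc a b))
    {p q x : ℝ} (hp : a ≤ p) (hq : q ≤ b) (hpx : p ≤ x) (hxq : x ≤ q) (h0 : F p = 0) :
    ‖F x‖ ^ 2 ≤ (q - p) * ∫ t in p..q, ‖f t‖ ^ 2 := by
  have hc : ContinuousOn (fun t => ‖f t‖) (Icc p q) := (hf.mono (Icc_subset_Icc hp hq)).norm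
  have h1 := h.integral_eq_sub (x := p) (y := x) ⟨hp, by linarith⟩ ⟨by linarith, by linarith⟩
  rw [h0, sub_zero] at h1
  have h2 : ‖F x‖ ≤ ∫ t in p..x, ‖f t‖ := by
    rw [← h1]; exact intervalIntegral.norm_integral_le_integral_norm hpx
  have h3 : ∫ t in p..x, ‖f t‖ ≤ ∫ t in p..q, ‖f t‖ :=
    intervalIntegral.integral_mono_interval le_rfl hpx hxq
      (Eventually.of_forall fun t => norm_nonneg _)
      (hc.intervalIntegrable_of_Icc (hpx.trans hxq))
  calc ‖F x‖ ^ 2 ≤ (∫ t in p..q, ‖f t‖) ^ 2 := by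
        gcongr; exact h2.trans h3
    _ ≤ _ := sq_integral_le (hpx.trans hxq) hc

theorem norm_sq_le_of_primitive_twice (h₀ : IsPrimitiveOn a b F₀ F₁) (h₁ : IsPrimitiveOn a b F₁ F₂)
    (hF₂ : ContinuousOn F₂ (Icc a b)) {p q x : ℝ} (hp : a ≤ p) (hq : q ≤ b) (hpx : p ≤ x)
    (hxq : x ≤ q) (z₀ : F₀ p = 0) (z₁ : F₁ p = 0) :
    ‖F₀ x‖ ^ 2 ≤ (q - p) ^ 3 * ∫ t in p..q, ‖F₂ t‖ ^ 2 := by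
  set A := ∫ t in p..q, ‖F₂ t‖ ^ 2
  have hA : 0 ≤ A := intervalIntegral.integral_nonneg (hpx.trans hxq) fun t _ => by positivity
  have hL : 0 ≤ q - p := by linarith
  have h1 : ‖F₀ x‖ ≤ Real.sqrt ((q - p) * A) * |x - p| := by
    have h2 := h₀.integral_eq_sub (x := p) (y := x) ⟨hp, by linarith⟩ ⟨by linarith, by linarith⟩
    rw [z₀, sub_zero] at h2
    rw [← h2]
    refine intervalIntegral.norm_integral_le_of_norm_le_const fun t ht => ?_
    rw [uIoc_of_le hpx] at ht
    exact Real.le_sqrt_of_sq_le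
      (h₁.norm_sq_le hF₂ hp hq ht.1.le (ht.2.trans hxq) z₁)
  rw [abs_of_nonneg (by linarith)] at h1
  calc ‖F₀ x‖ ^ 2 ≤ (Real.sqrt ((q - p) * A) * (q - p)) ^ 2 := by
        gcongr; exact h1.trans (by gcongr)
    _ = (q - p) ^ 3 * A := by
        rw [mul_pow, Real.sq_sqrt (by positivity)]; ring

/-- Poincaré's inequality. -/
theorem integral_norm_sq_le_of_primitive_twice (h₀ : IsPrimitiveOn a b F₀ F₁)
    (h₁ : IsPrimitiveOn a b F₁ F₂) (hF₂ : ContinuousOn F₂ (Icc a b)) {p q : ℝ} (hp : a ≤ p)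
    (hq : q ≤ b) (hpq : p ≤ q) (z₀ : F₀ p = 0) (z₁ : F₁ p = 0) :
    ∫ t in p..q, ‖F₀ t‖ ^ 2 ≤ (q - p) ^ 4 * ∫ t in p..q, ‖F₂ t‖ ^ 2 := by
  have hab : a ≤ b := by linarith
  have hc : ContinuousOn F₀ (Icc p q) := (h₀.continuousOn hab).mono (Icc_subset_Icc hp hq)
  calc ∫ t in p..q, ‖F₀ t‖ ^ 2 ≤ ∫ _ in p..q, (q - p) ^ 3 * ∫ t in p..q, ‖F₂ t‖ ^ 2 := by
        refine intervalIntegral.integral_mono_on hpq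
          ((hc.norm.pow 2).intervalIntegrable_of_Icc hpq) intervalIntegrable_const fun t ht => ?_
        exact norm_sq_le_of_primitive_twice h₀ h₁ hF₂ hp hq ht.1 ht.2 z₀ z₁
    _ = _ := by
        rw [intervalIntegral.integral_const, smul_eq_mul]; ring

/-- Poincaré's inequality for a function that vanishes with its derivative on a grid. -/
theorem integral_norm_sq_le_of_grid (h₀ : IsPrimitiveOn a b F₀ F₁)
    (h₁ : IsPrimitiveOn a b F₁ F₂) (hF₂ : ContinuousOn F₂ (Icc a b)) {p q : ℝ} (hp : a ≤ p)
    (hq : q ≤ b) (hpq : p ≤ q) {m : ℕ} (hm : 0 < m)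
    (z₀ : ∀ j < m, F₀ (p + j * ((q - p) / m)) = 0) (z₁ : ∀ j < m, F₁ (p + j * ((q - p) / m)) = 0) :
    ∫ t in p..q, ‖F₀ t‖ ^ 2 ≤ ((q - p) / m) ^ 4 * ∫ t in p..q, ‖F₂ t‖ ^ 2 := by
  have hab : a ≤ b := by linarith
  have hm' : (0 : ℝ) < m := by exact_mod_cast hm
  set h := (q - p) / m
  have hh : 0 ≤ h := div_nonneg (by linarith) hm'.le
  set x : ℕ → ℝ := fun j => p + j * h
  have hx0 : x 0 = p := by simp [x]
  have hxm : x m = q := by simp only [x, h]; field_simp; ring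
  have hxs : ∀ j, x (j + 1) - x j = h := fun j => by simp only [x]; push_cast; ring
  have hxge : ∀ j, p ≤ x j := fun j => by simp only [x]; nlinarith [(Nat.cast_nonneg j : (0:ℝ) ≤ j)]
  have hxle : ∀ j ≤ m, x j ≤ q := fun j hj => by
    rw [← hxm]; simp only [x]; gcongr
  have hint : ∀ F : ℝ → ℂ, ContinuousOn F (Icc a b) → ∀ j < m,
      IntervalIntegrable (fun t => ‖F t‖ ^ 2) volume (x j) (x (j + 1)) := by
    intro F hF j hj
    refine ContinuousOn.intervalIntegrable_of_Icc (by linarith [hxs j]) ?_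
    exact (hF.mono (Icc_subset_Icc (hp.trans (hxge j)) ((hxle _ hj).trans hq))).norm.pow 2
  have h0sum := intervalIntegral.sum_integral_adjacent_intervals
    (hint F₀ (h₀.continuousOn hab))
  have h2sum := intervalIntegral.sum_integral_adjacent_intervals (hint F₂ hF₂)
  rw [hx0, hxm] at h0sum h2sum
  rw [← h0sum, ← h2sum, Finset.mul_sum]
  -- Each cell uses only the vanishing at its left endpoint, so `m` grid points suffice and `q` is
  -- not among them.
  refine Finset.sum_le_sum fun j hj => ?_
  have hj' := Finset.mem_range.1 hj
  have := integral_norm_sq_le_of_primitive_twice h₀ h₁ hF₂ (hp.trans (hxge j))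
    ((hxle _ hj').trans hq) (by linarith [hxs j]) (z₀ j hj') (z₁ j hj')
  rwa [hxs j] at this

end Primitive

/-! ### The clamped biharmonic operator and its inverse -/

section Clamped

variable {a b : ℝ} {D E : ℕ → ℝ → ℂ}

theorem IsW24.continuousOn (hab : a ≤ b) (hD : IsW24 a b D) {j : ℕ} (hj : j < 4) :
    ContinuousOn (D j) (Icc a b) :=
  (hD.primitive j hj).continuousOn hab

theorem IsClamped.add (hD : IsClamped a b D) (hE : IsClamped a b E) :
    IsClamped a b (fun j x => D j x + E j x) := by
  obtain ⟨d1, d2, d3, d4⟩ := hD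
  obtain ⟨e1, e2, e3, e4⟩ := hE
  exact ⟨by simp [d1, e1], by simp [d2, e2], by simp [d3, e3], by simp [d4, e4]⟩

theorem IsClamped.const_mul (c : ℂ) (hD : IsClamped a b D) :
    IsClamped a b (fun j x => c * D j x) := by
  obtain ⟨d1, d2, d3, d4⟩ := hD
  exact ⟨by simp [d1], by simp [d2], by simp [d3], by simp [d4]⟩

/-- Two integrations by parts. All boundary terms carry a factor `E 0` or `E 1`, so only `E` has to
be clamped. -/
theorem integral_conj_mul_fourth (hab : a ≤ b) (hD : IsW24 a b D) (hE : IsW24 a b E)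
    (hcE : IsClamped a b E) :
    ∫ x in a..b, (starRingEnd ℂ) (E 0 x) * D 4 x = ∫ x in a..b, (starRingEnd ℂ) (E 2 x) * D 2 x := by
  obtain ⟨e1, e2, e3, e4⟩ := hcE
  have h1 := (hE.primitive 0 (by norm_num)).conj.integral_mul_add hab (hD.primitive 3 (by norm_num))
  have h2 := (hE.primitive 1 (by norm_num)).conj.integral_mul_add hab (hD.primitive 2 (by norm_num))
  simp only [e1, e2, e3, e4, zero_add, Nat.reduceAdd, map_zero, zero_mul, sub_zero] at h1 h2
  linear_combination h1 - h2

theorem IsClamped.norm_sq_le (hab : a ≤ b) (hD : IsW24 a b D) (hcD : IsClamped a b D) {x : ℝ}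
    (hx : x ∈ Icc a b) :
    ‖D 0 x‖ ^ 2 ≤ (b - a) ^ 3 * ∫ t in a..b, ‖D 2 t‖ ^ 2 :=
  norm_sq_le_of_primitive_twice (hD.primitive 0 (by norm_num)) (hD.primitive 1 (by norm_num))
    (hD.continuousOn hab (by norm_num)) le_rfl le_rfl hx.1 hx.2 hcD.1 hcD.2.1

theorem IsClamped.norm_sq_deriv_le (hab : a ≤ b) (hD : IsW24 a b D) (hcD : IsClamped a b D) {x : ℝ}
    (hx : x ∈ Icc a b) :
    ‖D 1 x‖ ^ 2 ≤ (b - a) * ∫ t in a..b, ‖D 2 t‖ ^ 2 :=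
  (hD.primitive 1 (by norm_num)).norm_sq_le
    (hD.continuousOn hab (by norm_num)) le_rfl le_rfl hx.1 hx.2 hcD.2.1

theorem integral_conj_mul_self (φ : ℝ → ℂ) :
    ∫ x in a..b, (starRingEnd ℂ) (φ x) * φ x = ((∫ x in a..b, ‖φ x‖ ^ 2 : ℝ) : ℂ) := by
  rw [← intervalIntegral.integral_ofReal]
  refine intervalIntegral.integral_congr fun x _ => ?_
  rw [← Complex.normSq_eq_conj_mul_self, Complex.normSq_eq_norm_sq]

theorem isW24_of_continuous {φ : ℕ → ℝ → ℂ} (h : ∀ j < 4, ∀ x, HasDerivAt (φ j) (φ (j + 1) x) x)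
    (hc : ∀ j, Continuous (φ j)) : IsW24 a b φ := by
  refine ⟨fun j hj => isPrimitiveOn_of_hasDerivAt (h j hj) (hc _), ?_⟩
  obtain ⟨C, hC⟩ := isCompact_Icc.exists_bound_of_continuousOn (s := Icc a b) (hc 4).continuousOn
  refine MemLp.of_bound (hc 4).aestronglyMeasurable C ?_
  exact (ae_restrict_iff' measurableSet_Ioo).2 (Eventually.of_forall fun x hx =>
    hC x (Ioo_subset_Icc_self hx))

theorem L2.intervalIntegrable (hab : a ≤ b) (h : L2 a b) : IntervalIntegrable h volume a b := by
  rw [intervalIntegrable_iff_integrableOn_Ioo_of_le hab]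
  exact (Lp.memLp h).integrable (by norm_num)

/-- The clamped problem `D'''' = h` is solvable. -/
theorem exists_clamped_solution (hab : a < b) (h : L2 a b) :
    ∃ D, IsW24 a b D ∧ IsClamped a b D ∧ h =ᵐ[volume.restrict (Ioo a b)] D 4 := by
  have hP : ∀ φ : ℝ → ℂ, IntervalIntegrable φ volume a b →
      IntervalIntegrable (fun x => ∫ t in a..x, φ t) volume a b := fun φ hφ =>
    ((isPrimitiveOn_integral hφ).continuousOn hab.le).intervalIntegrable_of_Icc hab.le
  -- Four integrations from `a` give a solution with zero data at `a`; a combination of `(x - a)²`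
  -- and `(x - a)³` then corrects the data at `b` without disturbing those of order 0 and 1 at `a`.
  set p3 : ℝ → ℂ := fun x => ∫ t in a..x, h t
  set p2 : ℝ → ℂ := fun x => ∫ t in a..x, p3 t
  set p1 : ℝ → ℂ := fun x => ∫ t in a..x, p2 t
  set p0 : ℝ → ℂ := fun x => ∫ t in a..x, p1 t
  have i4 := h.intervalIntegrable hab.le
  have i3 : IntervalIntegrable p3 volume a b := hP _ i4
  have i2 : IntervalIntegrable p2 volume a b := hP _ i3
  have i1 : IntervalIntegrable p1 volume a b := hP _ i2
  let P : ℕ → ℝ → ℂ := fun j => match j with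
    | 0 => p0
    | 1 => p1
    | 2 => p2
    | 3 => p3
    | _ => h
  have hPW : IsW24 a b P := by
    refine ⟨fun j hj => ?_, Lp.memLp h⟩
    interval_cases j
    · exact isPrimitiveOn_integral i1
    · exact isPrimitiveOn_integral i2
    · exact isPrimitiveOn_integral i3
    · exact isPrimitiveOn_integral i4
  let Q : ℕ → ℝ → ℂ := fun j x => match j with
    | 0 => ((x - a : ℝ) : ℂ) ^ 2
    | 1 => 2 * ((x - a : ℝ) : ℂ)
    | 2 => 2
    | _ => 0
  let R : ℕ → ℝ → ℂ := fun j x => match j with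
    | 0 => ((x - a : ℝ) : ℂ) ^ 3
    | 1 => 3 * ((x - a : ℝ) : ℂ) ^ 2
    | 2 => 6 * ((x - a : ℝ) : ℂ)
    | 3 => 6
    | _ => 0
  have hd : ∀ x : ℝ, HasDerivAt (fun x : ℝ => ((x - a : ℝ) : ℂ)) 1 x := fun x => by
    simpa using ((hasDerivAt_id x).sub_const a).ofReal_comp
  have hcont : Continuous (fun x : ℝ => ((x - a : ℝ) : ℂ)) := by fun_prop
  have hQW : IsW24 a b Q := by
    apply isW24_of_continuous
    · intro j hj x
      interval_cases j
      · convert! (hd x).pow 2 using 1; simp [Q]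
      · convert! (hd x).const_mul 2 using 1; simp [Q]
      · exact hasDerivAt_const x 2
      · exact hasDerivAt_const x 0
    · intro j
      match j with
      | 0 => exact hcont.pow 2
      | 1 => exact continuous_const.mul hcont
      | 2 => exact continuous_const
      | _ + 3 => exact continuous_const
  have hRW : IsW24 a b R := by
    apply isW24_of_continuous
    · intro j hj x
      interval_cases j
      · convert! (hd x).pow 3 using 1; simp [R]
      · convert! ((hd x).pow 2).const_mul 3 using 1; simp [R]; ring
      · convert! (hd x).const_mul 6 using 1; simp [R]
      · exact hasDerivAt_const x 6
    · intro j
      match j with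
      | 0 => exact hcont.pow 3
      | 1 => exact continuous_const.mul (hcont.pow 2)
      | 2 => exact continuous_const.mul hcont
      | 3 => exact continuous_const
      | _ + 4 => exact continuous_const
  set ℓ : ℂ := ((b - a : ℝ) : ℂ)
  have hℓ : ℓ ≠ 0 := Complex.ofReal_ne_zero.2 (sub_pos.2 hab).ne'
  -- `s` and `t` solve the two linear equations for value and slope at `b`.
  set t : ℂ := (2 * p0 b - ℓ * p1 b) / ℓ ^ 3
  set s : ℂ := (-3 * p0 b + ℓ * p1 b) / ℓ ^ 2
  refine ⟨_, hPW.add ((hQW.const_mul s).add (hRW.const_mul t)), ⟨?_, ?_, ?_, ?_⟩, ?_⟩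
  · simp [P, Q, R, p0]
  · simp [P, Q, R, p1]
  · change p0 b + (s * ℓ ^ 2 + t * ℓ ^ 3) = 0
    simp only [s, t]; field_simp; ring
  · change p1 b + (s * (2 * ℓ) + t * (3 * ℓ ^ 2)) = 0
    simp only [s, t]; field_simp; ring
  · refine Eventually.of_forall fun x => ?_
    change h x = h x + (s * 0 + t * 0)
    ring

/-! ### Inner products in `L2 a b` and uniqueness for the clamped problem -/

theorem integral_Ioo_eq_intervalIntegral (hab : a ≤ b) (φ : ℝ → ℂ) :
    ∫ x, φ x ∂(volume.restrict (Ioo a b)) = ∫ x in a..b, φ x := by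
  rw [intervalIntegral.integral_of_le hab, integral_Ioc_eq_integral_Ioo]

theorem L2.inner_eq (hab : a ≤ b) {f g : L2 a b} {φ ψ : ℝ → ℂ}
    (hf : f =ᵐ[volume.restrict (Ioo a b)] φ) (hg : g =ᵐ[volume.restrict (Ioo a b)] ψ) :
    inner ℂ f g = ∫ x in a..b, (starRingEnd ℂ) (φ x) * ψ x := by
  rw [MeasureTheory.L2.inner_def, ← integral_Ioo_eq_intervalIntegral hab]
  refine integral_congr_ae ?_
  filter_upwards [hf, hg] with x h1 h2
  rw [h1, h2, RCLike.inner_apply, mul_comm]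

theorem L2.norm_sq_eq (hab : a ≤ b) {f : L2 a b} {φ : ℝ → ℂ}
    (hf : f =ᵐ[volume.restrict (Ioo a b)] φ) : ‖f‖ ^ 2 = ∫ x in a..b, ‖φ x‖ ^ 2 := by
  have h1 := L2.inner_eq hab hf hf
  rw [integral_conj_mul_self, inner_self_eq_norm_sq_to_K] at h1
  apply Complex.ofReal_injective
  rw [← h1, Complex.ofReal_pow]
  rfl

/-- Pairing `D 4 = 0` with `D 0` gives `∫ ‖D 2‖² = 0`, and the pointwise bounds by this energy force
value and slope to vanish. -/
theorem IsClamped.eq_zero (hab : a ≤ b) (hD : IsW24 a b D) (hcD : IsClamped a b D)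
    (h4 : D 4 =ᵐ[volume.restrict (Ioo a b)] 0) {x : ℝ} (hx : x ∈ Icc a b) :
    D 0 x = 0 ∧ D 1 x = 0 := by
  have h1 := integral_conj_mul_fourth hab hD hD hcD
  have h2 : ∫ x in a..b, (starRingEnd ℂ) (D 0 x) * D 4 x = 0 := by
    rw [← integral_Ioo_eq_intervalIntegral hab]
    refine integral_eq_zero_of_ae ?_
    filter_upwards [h4] with x hx
    simp [hx]
  rw [h2, integral_conj_mul_self] at h1
  have h3 : ∫ x in a..b, ‖D 2 x‖ ^ 2 = 0 := by exact_mod_cast h1.symm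
  have h5 := hcD.norm_sq_le hab hD hx
  have h6 := hcD.norm_sq_deriv_le hab hD hx
  rw [h3, mul_zero] at h5 h6
  constructor
  · simpa using le_antisymm h5 (by positivity)
  · simpa using le_antisymm h6 (by positivity)

theorem clamped_solution_unique (hab : a ≤ b) (hD : IsW24 a b D) (hcD : IsClamped a b D)
    (hE : IsW24 a b E) (hcE : IsClamped a b E) (h4 : D 4 =ᵐ[volume.restrict (Ioo a b)] E 4) {x : ℝ}
    (hx : x ∈ Icc a b) : D 0 x = E 0 x ∧ D 1 x = E 1 x := by
  have h1 := (hcD.add (hcE.const_mul (-1))).eq_zero hab (hD.add (hE.const_mul (-1)))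
    (by filter_upwards [h4] with x hx; simp [hx]) hx
  constructor
  · linear_combination h1.1
  · linear_combination h1.2

theorem memLp_of_continuousOn {φ : ℝ → ℂ} (hφ : ContinuousOn φ (Icc a b)) :
    MemLp φ 2 (volume.restrict (Ioo a b)) := by
  obtain ⟨C, hC⟩ := isCompact_Icc.exists_bound_of_continuousOn hφ
  refine MemLp.of_bound
    ((hφ.mono Ioo_subset_Icc_self).aestronglyMeasurable measurableSet_Ioo) C ?_
  exact (ae_restrict_iff' measurableSet_Ioo).2 (Eventually.of_forall fun x hx =>
    hC x (Ioo_subset_Icc_self hx))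

/-- A solution of the clamped problem `D'''' = h`. -/
noncomputable def clampedSolution (hab : a < b) (h : L2 a b) : ℕ → ℝ → ℂ :=
  (exists_clamped_solution hab h).choose

theorem isW24_clampedSolution (hab : a < b) (h : L2 a b) : IsW24 a b (clampedSolution hab h) :=
  (exists_clamped_solution hab h).choose_spec.1

theorem isClamped_clampedSolution (hab : a < b) (h : L2 a b) :
    IsClamped a b (clampedSolution hab h) :=
  (exists_clamped_solution hab h).choose_spec.2.1

theorem clampedSolution_fourth (hab : a < b) (h : L2 a b) :
    h =ᵐ[volume.restrict (Ioo a b)] clampedSolution hab h 4 :=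
  (exists_clamped_solution hab h).choose_spec.2.2

theorem clampedSolution_eq (hab : a < b) {h : L2 a b} (hD : IsW24 a b D) (hcD : IsClamped a b D)
    (h4 : h =ᵐ[volume.restrict (Ioo a b)] D 4) {x : ℝ} (hx : x ∈ Icc a b) :
    clampedSolution hab h 0 x = D 0 x ∧ clampedSolution hab h 1 x = D 1 x :=
  clamped_solution_unique hab.le (isW24_clampedSolution hab h) (isClamped_clampedSolution hab h)
    hD hcD ((clampedSolution_fourth hab h).symm.trans h4) hx

theorem clampedSolution_add (hab : a < b) (h k : L2 a b) {x : ℝ} (hx : x ∈ Icc a b) :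
    clampedSolution hab (h + k) 0 x = clampedSolution hab h 0 x + clampedSolution hab k 0 x ∧
    clampedSolution hab (h + k) 1 x = clampedSolution hab h 1 x + clampedSolution hab k 1 x :=
  clampedSolution_eq hab ((isW24_clampedSolution hab h).add (isW24_clampedSolution hab k))
    ((isClamped_clampedSolution hab h).add (isClamped_clampedSolution hab k))
    (by
      filter_upwards [Lp.coeFn_add h k, clampedSolution_fourth hab h,
        clampedSolution_fourth hab k] with y h1 h2 h3
      rw [h1, Pi.add_apply, h2, h3]) hx

theorem clampedSolution_smul (hab : a < b) (c : ℂ) (h : L2 a b) {x : ℝ} (hx : x ∈ Icc a b) :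
    clampedSolution hab (c • h) 0 x = c * clampedSolution hab h 0 x ∧
    clampedSolution hab (c • h) 1 x = c * clampedSolution hab h 1 x :=
  clampedSolution_eq hab ((isW24_clampedSolution hab h).const_mul c)
    ((isClamped_clampedSolution hab h).const_mul c)
    (by
      filter_upwards [Lp.coeFn_smul c h, clampedSolution_fourth hab h] with y h1 h2
      rw [h1, Pi.smul_apply, h2, smul_eq_mul]) hx

/-- The value and the slope at `x` of the solution of the clamped problem. -/
noncomputable def clampedEval (hab : a < b) {x : ℝ} (hx : x ∈ Icc a b) : L2 a b →ₗ[ℂ] ℂ × ℂ where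
  toFun h := (clampedSolution hab h 0 x, clampedSolution hab h 1 x)
  map_add' h k := Prod.ext (clampedSolution_add hab h k hx).1 (clampedSolution_add hab h k hx).2
  map_smul' c h := Prod.ext (clampedSolution_smul hab c h hx).1 (clampedSolution_smul hab c h hx).2

theorem memLp_clampedSolution (hab : a < b) (h : L2 a b) :
    MemLp (clampedSolution hab h 0) 2 (volume.restrict (Ioo a b)) :=
  memLp_of_continuousOn ((isW24_clampedSolution hab h).continuousOn hab.le (by norm_num))

theorem ae_restrict_of_forall_Icc {p : ℝ → Prop} (h : ∀ x ∈ Icc a b, p x) :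
    ∀ᵐ x ∂(volume.restrict (Ioo a b)), p x :=
  (ae_restrict_iff' measurableSet_Ioo).2 (Eventually.of_forall fun x hx =>
    h x (Ioo_subset_Icc_self hx))

/-- The inverse of the clamped operator `d^4/dx^4`, as a linear map. -/
noncomputable def clampedInverseₗ (hab : a < b) : L2 a b →ₗ[ℂ] L2 a b where
  toFun h := (memLp_clampedSolution hab h).toLp _
  map_add' h k := by
    rw [← MemLp.toLp_add]
    exact MemLp.toLp_congr _ _ (ae_restrict_of_forall_Icc fun x hx =>
      (clampedSolution_add hab h k hx).1)
  map_smul' c h := by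
    rw [RingHom.id_apply, ← MemLp.toLp_const_smul]
    exact MemLp.toLp_congr _ _ (ae_restrict_of_forall_Icc fun x hx =>
      (clampedSolution_smul hab c h hx).1)

theorem clampedInverseₗ_ae (hab : a < b) (h : L2 a b) :
    clampedInverseₗ hab h =ᵐ[volume.restrict (Ioo a b)] clampedSolution hab h 0 :=
  MemLp.coeFn_toLp (memLp_clampedSolution hab h)

theorem inner_clampedInverseₗ (hab : a < b) (h k : L2 a b) :
    inner ℂ (clampedInverseₗ hab h) k =
      ∫ x in a..b, (starRingEnd ℂ) (clampedSolution hab h 2 x) * clampedSolution hab k 2 x := by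
  rw [L2.inner_eq hab.le (clampedInverseₗ_ae hab h) (clampedSolution_fourth hab k)]
  exact integral_conj_mul_fourth hab.le (isW24_clampedSolution hab k) (isW24_clampedSolution hab h)
    (isClamped_clampedSolution hab h)

/-- Both sides equal the symmetric energy form in the second derivatives of the two solutions. -/
theorem clampedInverseₗ_isSymmetric (hab : a < b) : (clampedInverseₗ hab).IsSymmetric := by
  intro h k
  rw [← inner_conj_symm h, inner_clampedInverseₗ, inner_clampedInverseₗ,
    intervalIntegral.integral_of_le hab.le, intervalIntegral.integral_of_le hab.le,
    ← integral_conj]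
  simp only [map_mul, Complex.conj_conj, mul_comm]

/-- The inverse of the clamped operator `d^4/dx^4`. -/
noncomputable def clampedInverse (hab : a < b) : L2 a b →L[ℂ] L2 a b :=
  -- Hellinger–Toeplitz: a symmetric operator defined on the whole space is bounded.
  ⟨clampedInverseₗ hab, (clampedInverseₗ_isSymmetric hab).continuous⟩

theorem clampedInverse_ae (hab : a < b) (h : L2 a b) :
    clampedInverse hab h =ᵐ[volume.restrict (Ioo a b)] clampedSolution hab h 0 :=
  clampedInverseₗ_ae hab h

theorem inner_clampedInverse_self (hab : a < b) (h : L2 a b) :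
    (inner ℂ (clampedInverse hab h) h).re = ∫ x in a..b, ‖clampedSolution hab h 2 x‖ ^ 2 := by
  have h1 : (inner ℂ (clampedInverse hab h) h : ℂ) = _ := inner_clampedInverseₗ hab h h
  rw [h1, integral_conj_mul_self, Complex.ofReal_re]

/-! ### Compactness of the inverse -/

theorem integral_clampedSolution_le (hab : a < b) (h : L2 a b) :
    ∫ x in a..b, ‖clampedSolution hab h 2 x‖ ^ 2 ≤ ‖clampedInverse hab h‖ * ‖h‖ := by
  rw [← inner_clampedInverse_self]
  exact (Complex.re_le_norm _).trans (norm_inner_le_norm _ _)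

/-- Value and slope at a point are controlled by the energy, which is at most `‖G‖ ‖h‖²` for `G =
clampedInverse hab`. Continuity makes the grid conditions cut out closed subspaces. -/
theorem continuous_clampedEval (hab : a < b) {x : ℝ} (hx : x ∈ Icc a b) :
    Continuous (clampedEval hab hx) := by
  set C : ℝ := Real.sqrt (((b - a) ^ 3 + (b - a)) * ‖clampedInverse hab‖)
  have hba : 0 < b - a := sub_pos.2 hab
  refine AddMonoidHomClass.continuous_of_bound (clampedEval hab hx) C fun h => ?_
  have h1 := integral_clampedSolution_le hab h
  have h2 : ‖clampedInverse hab h‖ * ‖h‖ ≤ ‖clampedInverse hab‖ * ‖h‖ ^ 2 := by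
    rw [sq, ← mul_assoc]; gcongr; exact (clampedInverse hab).le_opNorm h
  have hA := h1.trans h2
  have hA0 : 0 ≤ ∫ x in a..b, ‖clampedSolution hab h 2 x‖ ^ 2 :=
    intervalIntegral.integral_nonneg hab.le fun x _ => by positivity
  have h3 := (isClamped_clampedSolution hab h).norm_sq_le hab.le (isW24_clampedSolution hab h) hx
  have h4 := (isClamped_clampedSolution hab h).norm_sq_deriv_le hab.le
    (isW24_clampedSolution hab h) hx
  have key : ∀ z : ℂ, ‖z‖ ^ 2 ≤ ((b - a) ^ 3 + (b - a)) * ∫ x in a..b, ‖clampedSolution hab h 2 x‖ ^ 2 →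
      ‖z‖ ≤ C * ‖h‖ := by
    intro z hz
    refine abs_le_of_sq_le_sq' ?_ (by positivity) |>.2
    rw [mul_pow, Real.sq_sqrt (by positivity)]
    calc ‖z‖ ^ 2 ≤ _ := hz
      _ ≤ ((b - a) ^ 3 + (b - a)) * (‖clampedInverse hab‖ * ‖h‖ ^ 2) := by gcongr
      _ = _ := by ring
  refine max_le (key _ (h3.trans ?_)) (key _ (h4.trans ?_))
  · gcongr; linarith
  · gcongr; nlinarith [pow_pos hba 3]

theorem grid_mem_Icc (hab : a ≤ b) {m j : ℕ} (hj : j < m) : a + j * ((b - a) / m) ∈ Icc a b := by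
  have hm : (0 : ℝ) < m := by exact_mod_cast (Nat.zero_le j).trans_lt hj
  have hba : 0 ≤ b - a := sub_nonneg.2 hab
  constructor
  · have : 0 ≤ j * ((b - a) / m) := by positivity
    linarith
  · have h1 : j * ((b - a) / m) ≤ m * ((b - a) / m) := by gcongr
    have h2 : m * ((b - a) / m) = b - a := by field_simp
    linarith

/-- With `G = clampedInverse hab`, Poincaré bounds `‖G h‖²` by `((b - a) / m)⁴` times the energy,
and the energy is at most `‖G h‖ ‖h‖`; one factor `‖G h‖` cancels. -/
theorem norm_clampedInverse_le_of_grid (hab : a < b) {m : ℕ} (hm : 0 < m) {h : L2 a b}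
    (hz : ∀ j : Fin m, clampedEval hab (grid_mem_Icc hab.le j.2) h = 0) :
    ‖clampedInverse hab h‖ ≤ ((b - a) / m) ^ 4 * ‖h‖ := by
  have hD := isW24_clampedSolution hab h
  have h1 := integral_norm_sq_le_of_grid (hD.primitive 0 (by norm_num))
    (hD.primitive 1 (by norm_num)) (hD.continuousOn hab.le (by norm_num)) le_rfl le_rfl hab.le hm
    (fun j hj => congrArg Prod.fst (hz ⟨j, hj⟩)) (fun j hj => congrArg Prod.snd (hz ⟨j, hj⟩))
  rw [← L2.norm_sq_eq hab.le (clampedInverse_ae hab h)] at h1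
  have hba : 0 < b - a := sub_pos.2 hab
  have h2 : ‖clampedInverse hab h‖ ^ 2 ≤
      ((b - a) / m) ^ 4 * (‖clampedInverse hab h‖ * ‖h‖) :=
    h1.trans (by gcongr; exact integral_clampedSolution_le hab h)
  by_contra hlt
  rw [not_le] at hlt
  have h0 : 0 < ‖clampedInverse hab h‖ := lt_of_le_of_lt (by positivity) hlt
  nlinarith

/-- The grid conditions define a subspace `Z m` of finite codimension on which `G` has norm at most
`((b - a) / m)⁴`. So `G` is the norm limit of the finite-rank operators obtained by first projecting
onto `(Z m)ᗮ`. -/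
theorem isCompactOperator_clampedInverse (hab : a < b) :
    IsCompactOperator (clampedInverse hab) := by
  set G := clampedInverse hab
  let L : ∀ m : ℕ, L2 a b →L[ℂ] (Fin m → ℂ × ℂ) := fun m => ContinuousLinearMap.pi fun j =>
    ⟨clampedEval hab (grid_mem_Icc hab.le j.2), continuous_clampedEval hab _⟩
  let Z : ℕ → Submodule ℂ (L2 a b) := fun m => LinearMap.ker (L m).toLinearMap
  have hcl : ∀ m, IsClosed (Z m : Set (L2 a b)) := fun m => (L m).isClosed_ker
  have : ∀ m, CompleteSpace (Z m) := fun m => (hcl m).completeSpace_coe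
  have hfin : ∀ m, FiniteDimensional ℂ (Z m)ᗮ := by
    intro m
    refine FiniteDimensional.of_injective ((L m).toLinearMap.comp (Z m)ᗮ.subtype) ?_
    rw [← LinearMap.ker_eq_bot, LinearMap.ker_eq_bot']
    intro x hx
    have h1 : (x : L2 a b) ∈ Z m := hx
    have h2 := (Submodule.mem_orthogonal _ _).1 x.2 _ h1
    exact Subtype.ext (inner_self_eq_zero.1 h2)
  have hlim : Tendsto (fun m : ℕ => G ∘L (Z m)ᗮ.starProjection) atTop (𝓝 G) := by
    rw [tendsto_iff_norm_sub_tendsto_zero]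
    have hz : Tendsto (fun m : ℕ => ((b - a) / (m : ℝ)) ^ 4) atTop (𝓝 0) := by
      have := (tendsto_const_div_atTop_nhds_zero_nat (b - a)).pow 4
      simpa using this
    refine squeeze_zero' (Eventually.of_forall fun m => norm_nonneg _) ?_ hz
    filter_upwards [eventually_gt_atTop 0] with m hm
    refine ContinuousLinearMap.opNorm_le_bound _ (by positivity) fun h => ?_
    have h1 : (G ∘L (Z m)ᗮ.starProjection - G) h = -G ((Z m).starProjection h) := by
      have h2 := (Z m).starProjection_add_starProjection_orthogonal h
      change G ((Z m)ᗮ.starProjection h) - G h = _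
      nth_rewrite 2 [← h2]
      rw [map_add]; abel
    rw [h1, norm_neg]
    have h3 : L m ((Z m).starProjection h) = 0 := (Z m).starProjection_apply_mem h
    have h4 := norm_clampedInverse_le_of_grid hab hm (h := (Z m).starProjection h)
      (fun j => congrFun h3 j)
    have hba : 0 < b - a := sub_pos.2 hab
    exact h4.trans (by gcongr; exact (Z m).norm_starProjection_apply_le h)
  refine isCompactOperator_of_tendsto hlim (Eventually.of_forall fun m => ?_)
  have hp : ProperSpace (Z m)ᗮ := FiniteDimensional.proper ℂ _
  have h1 : IsCompactOperator (G ∘L (Z m)ᗮ.subtypeL) :=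
    isCompactOperator_of_locallyCompactSpace_rng _
  exact h1.comp_clm (Z m)ᗮ.orthogonalProjectionOnto

theorem isCompactPositive_clampedInverse (hab : a < b) : IsCompactPositive (clampedInverse hab) := by
  refine ⟨isCompactOperator_clampedInverse hab, clampedInverseₗ_isSymmetric hab, fun h => ?_,
    fun h hh => ?_⟩
  · rw [inner_clampedInverse_self]
    exact intervalIntegral.integral_nonneg hab.le fun x _ => by positivity
  · have h1 := clampedInverse_ae hab h
    rw [hh] at h1
    have h0 : clampedSolution hab h 0 =ᵐ[volume.restrict (Ioo a b)] 0 :=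
      h1.symm.trans (Lp.coeFn_zero _ _ _)
    have hj : ∀ j ≤ 4, clampedSolution hab h j =ᵐ[volume.restrict (Ioo a b)] 0 := by
      intro j
      induction j with
      | zero => exact fun _ => h0
      | succ j ih =>
        exact fun hj =>
          ((isW24_clampedSolution hab h).primitive j (by omega)).ae_eq_zero (ih (by omega))
    rw [Lp.eq_zero_iff_ae_eq_zero]
    exact (clampedSolution_fourth hab h).trans (hj 4 le_rfl)

end Clamped

/-! ### Spectrum of the clamped operator with a continuous potential -/

section Potential

variable {a b : ℝ} {V W : ℝ → ℝ}

theorem norm_bound_of_continuousOn (hV : ContinuousOn V (Icc a b)) :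
    ∃ C, 0 ≤ C ∧ ∀ x ∈ Icc a b, |V x| ≤ C := by
  obtain ⟨C, hC⟩ := isCompact_Icc.exists_bound_of_continuousOn hV
  exact ⟨max C 0, le_max_right _ _, fun x hx => (hC x hx).trans (le_max_left _ _)⟩

theorem memLp_potential_mul (hV : ContinuousOn V (Icc a b)) (u : L2 a b) :
    MemLp (fun x => (V x : ℂ) * u x) 2 (volume.restrict (Ioo a b)) := by
  obtain ⟨C, -, hC⟩ := norm_bound_of_continuousOn hV
  refine MemLp.of_le_mul (c := C) (Lp.memLp u) ?_ (ae_restrict_of_forall_Icc fun x hx => ?_)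
  · refine AEStronglyMeasurable.mul ?_ (Lp.aestronglyMeasurable u)
    exact (Complex.continuous_ofReal.comp_continuousOn
      (hV.mono Ioo_subset_Icc_self)).aestronglyMeasurable measurableSet_Ioo
  · rw [norm_mul, Complex.norm_real]
    gcongr
    exact hC x hx

/-- Multiplication by a continuous potential. -/
noncomputable def potentialₗ (hV : ContinuousOn V (Icc a b)) : L2 a b →ₗ[ℂ] L2 a b where
  toFun u := (memLp_potential_mul hV u).toLp _
  map_add' u v := by
    rw [← MemLp.toLp_add]
    refine MemLp.toLp_congr _ _ ?_
    filter_upwards [Lp.coeFn_add u v] with x hx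
    rw [hx, Pi.add_apply, Pi.add_apply, mul_add]
  map_smul' c u := by
    rw [RingHom.id_apply, ← MemLp.toLp_const_smul]
    refine MemLp.toLp_congr _ _ ?_
    filter_upwards [Lp.coeFn_smul c u] with x hx
    rw [hx, Pi.smul_apply, Pi.smul_apply, smul_eq_mul, smul_eq_mul, mul_left_comm]

theorem potentialₗ_ae (hV : ContinuousOn V (Icc a b)) (u : L2 a b) :
    potentialₗ hV u =ᵐ[volume.restrict (Ioo a b)] fun x => (V x : ℂ) * u x :=
  MemLp.coeFn_toLp (memLp_potential_mul hV u)

theorem norm_potentialₗ_le (hV : ContinuousOn V (Icc a b)) {C : ℝ} (hC : ∀ x ∈ Icc a b, |V x| ≤ C)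
    (u : L2 a b) : ‖potentialₗ hV u‖ ≤ C * ‖u‖ := by
  refine Lp.norm_le_mul_norm_of_ae_le_mul ?_
  filter_upwards [potentialₗ_ae hV u, ae_restrict_of_forall_Icc hC] with x h1 h2
  rw [h1, norm_mul, Complex.norm_real]
  gcongr
  exact h2

theorem potentialₗ_isSymmetric (hV : ContinuousOn V (Icc a b)) : (potentialₗ hV).IsSymmetric := by
  intro u v
  rw [MeasureTheory.L2.inner_def, MeasureTheory.L2.inner_def]
  refine integral_congr_ae ?_
  filter_upwards [potentialₗ_ae hV u, potentialₗ_ae hV v] with x h1 h2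
  rw [h1, h2, RCLike.inner_apply, RCLike.inner_apply, map_mul, Complex.conj_ofReal]
  ring

/-- Uniqueness for the clamped problem identifies any admissible `D` with the chosen solution. The
equation takes the form `G (f - V u) = u` required by `IsCompactPositive.exists_resolvent`. -/
theorem mem_clampedGraph_iff (hab : a < b) (hV : ContinuousOn V (Icc a b)) (u f : L2 a b) :
    (u, f) ∈ clampedGraph a b V ↔ clampedInverse hab (f - potentialₗ hV u) = u := by
  constructor
  · rintro ⟨D, hD, hcD, hu, hf⟩
    have h4 : (f - potentialₗ hV u : L2 a b) =ᵐ[volume.restrict (Ioo a b)] D 4 := by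
      filter_upwards [Lp.coeFn_sub f (potentialₗ hV u), potentialₗ_ae hV u, hu, hf] with x h1 h2 h3 h4
      rw [h1, Pi.sub_apply, h2, h3, h4]
      ring
    apply Lp.ext
    refine (clampedInverse_ae hab _).trans (EventuallyEq.trans ?_ hu.symm)
    exact ae_restrict_of_forall_Icc fun x hx => (clampedSolution_eq hab hD hcD h4 hx).1
  · intro h
    have h1 := clampedInverse_ae hab (f - potentialₗ hV u)
    rw [h] at h1
    refine ⟨_, isW24_clampedSolution hab (f - potentialₗ hV u),
      isClamped_clampedSolution hab _, h1, ?_⟩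
    filter_upwards [Lp.coeFn_sub f (potentialₗ hV u), potentialₗ_ae hV u, h1,
      clampedSolution_fourth hab (f - potentialₗ hV u)] with x h2 h3 h4 h5
    rw [← h5, h2, Pi.sub_apply, h3, ← h4]
    ring

theorem exists_enumeratesEigenvalues_clampedOperator (hab : a < b)
    (hinf : ¬ FiniteDimensional ℂ (L2 a b)) (hV : ContinuousOn V (Icc a b)) :
    ∃ ev : ℕ → ℝ, EnumeratesEigenvalues (clampedOperator a b V) ev ∧
      IsMinMax (clampedGraph a b V) ev := by
  have hsym := potentialₗ_isSymmetric hV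
  obtain ⟨K, c, hK, hKc⟩ := (isCompactPositive_clampedInverse hab).exists_resolvent
    (V := ⟨potentialₗ hV, hsym.continuous⟩) hsym
  have h := exists_enumeratesEigenvalues_of_resolvent hinf (T := clampedOperator a b V) hK (c := c)
    (fun u f => by
      rw [clampedOperator_graph, mem_clampedGraph_iff hab hV, ← hKc]; rfl)
  rwa [clampedOperator_graph] at h

theorem re_inner_clampedGraph (hab : a ≤ b) (hV : ContinuousOn V (Icc a b)) {p : L2 a b × L2 a b}
    {D : ℕ → ℝ → ℂ} (hD : IsW24 a b D) (hcD : IsClamped a b D)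
    (h1 : p.1 =ᵐ[volume.restrict (Ioo a b)] D 0)
    (h2 : p.2 =ᵐ[volume.restrict (Ioo a b)] fun x => D 4 x + (V x : ℂ) * D 0 x) :
    (inner ℂ p.2 p.1).re =
      (∫ x in a..b, ‖D 2 x‖ ^ 2) + ∫ x in a..b, V x * ‖D 0 x‖ ^ 2 := by
  have hc0 : ContinuousOn (fun x => (starRingEnd ℂ) (D 0 x)) (uIcc a b) := by
    rw [uIcc_of_le hab]
    exact Complex.continuous_conj.comp_continuousOn (hD.continuousOn hab (by norm_num))
  have hcV : ContinuousOn (fun x => (starRingEnd ℂ) (D 0 x) * ((V x : ℂ) * D 0 x)) (uIcc a b) := by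
    refine hc0.mul ?_
    rw [uIcc_of_le hab]
    exact (Complex.continuous_ofReal.comp_continuousOn hV).mul (hD.continuousOn hab (by norm_num))
  rw [← inner_conj_symm, Complex.conj_re, L2.inner_eq hab h1 h2]
  simp only [mul_add]
  rw [intervalIntegral.integral_add ((hD.primitive 3 (by norm_num)).1.continuousOn_mul hc0)
    hcV.intervalIntegrable, integral_conj_mul_fourth hab hD hD hcD, integral_conj_mul_self]
  have h3 : ∫ x in a..b, (starRingEnd ℂ) (D 0 x) * ((V x : ℂ) * D 0 x) =
      ((∫ x in a..b, V x * ‖D 0 x‖ ^ 2 : ℝ) : ℂ) := by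
    rw [← intervalIntegral.integral_ofReal]
    refine intervalIntegral.integral_congr fun x _ => ?_
    rw [mul_left_comm, ← Complex.normSq_eq_conj_mul_self, Complex.normSq_eq_norm_sq,
      Complex.ofReal_mul]
  rw [h3, ← Complex.ofReal_add, Complex.ofReal_re]

/-! ### Bounds and comparison by min-max -/

theorem IsMinMax.le_of_forall_le {Γ : Submodule ℂ (L2 a b × L2 a b)}
    (hΓ : ∀ p ∈ Γ, p.1 = 0 → p.2 = 0) {ev : ℕ → ℝ} (h : IsMinMax Γ ev) {k : ℕ} {C : ℝ}
    {E : Submodule ℂ (L2 a b × L2 a b)} (hE : E ≤ Γ) (hk : Module.finrank ℂ E = k + 1)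
    (hC : ∀ p ∈ E, (inner ℂ p.2 p.1).re ≤ C * ‖p.1‖ ^ 2) : ev k ≤ C := by
  obtain ⟨p, hp, hp0, hle⟩ := h.exists_ge k E hE hk
  have h1 : p.1 ≠ 0 := fun h1 => hp0 (Prod.ext h1 (hΓ p (hE hp) h1))
  have h2 : 0 < ‖p.1‖ ^ 2 := by positivity
  exact le_of_mul_le_mul_right (hle.trans (hC p hp)) h2

/-- The domain does not depend on the potential: the shear `(u, f) ↦ (u, f + (V - W) u)` carries one
graph into the other, keeps dimensions, and changes the form by at most `δ ‖u‖²`. -/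
theorem IsMinMax.le_add (hV : ContinuousOn V (Icc a b))
    (hW : ContinuousOn W (Icc a b)) {δ : ℝ} (hδ : ∀ x ∈ Icc a b, |V x - W x| ≤ δ)
    {ev ew : ℕ → ℝ} (hev : IsMinMax (clampedGraph a b V) ev)
    (hew : IsMinMax (clampedGraph a b W) ew) (k : ℕ) : ev k ≤ ew k + δ := by
  have hVW : ContinuousOn (fun x => V x - W x) (Icc a b) := hV.sub hW
  obtain ⟨E, hE, hk, hle⟩ := hew.exists_le k
  set M := potentialₗ hVW
  let S : L2 a b × L2 a b →ₗ[ℂ] L2 a b × L2 a b :=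
    (LinearMap.fst ℂ _ _).prod (LinearMap.snd ℂ _ _ + M.comp (LinearMap.fst ℂ _ _))
  have hSa : ∀ p, S p = (p.1, p.2 + M p.1) := fun p => rfl
  have hSinj : Function.Injective S := by
    rw [← LinearMap.ker_eq_bot, LinearMap.ker_eq_bot']
    intro p hp
    rw [hSa, Prod.mk_eq_zero] at hp
    have h2 := hp.2
    rw [hp.1, map_zero, add_zero] at h2
    exact Prod.ext hp.1 h2
  refine hev.le_of_forall_le (clampedGraph_functional a b V) (E := E.map S) ?_ ?_ ?_
  · rintro _ ⟨p, hp, rfl⟩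
    obtain ⟨D, hD, hcD, h1, h2⟩ := hE hp
    refine ⟨D, hD, hcD, h1, ?_⟩
    filter_upwards [Lp.coeFn_add p.2 (M p.1), potentialₗ_ae hVW p.1, h1, h2] with x h3 h4 h5 h6
    rw [hSa]
    change (p.2 + M p.1 : L2 a b) x = _
    rw [h3, Pi.add_apply, h4, h5, h6]
    push_cast
    ring
  · rw [← hk]
    exact (Submodule.equivMapOfInjective S hSinj E).finrank_eq.symm
  · rintro _ ⟨p, hp, rfl⟩
    rw [hSa]
    change (inner ℂ (p.2 + M p.1) p.1).re ≤ _ * ‖p.1‖ ^ 2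
    rw [inner_add_left, Complex.add_re]
    have h1 := hle p hp
    have h2 : (inner ℂ (M p.1) p.1).re ≤ δ * ‖p.1‖ ^ 2 := by
      calc (inner ℂ (M p.1) p.1).re ≤ ‖inner ℂ (M p.1) p.1‖ := Complex.re_le_norm _
        _ ≤ ‖M p.1‖ * ‖p.1‖ := norm_inner_le_norm _ _
        _ ≤ δ * ‖p.1‖ * ‖p.1‖ := by gcongr; exact norm_potentialₗ_le hVW hδ p.1
        _ = _ := by ring
    linarith

/-- A lower bound on a subspace of finite codimension. -/
theorem IsMinMax.le_of_grid (hab : a < b) (hV : ContinuousOn V (Icc a b)) {ev : ℕ → ℝ}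
    (hev : IsMinMax (clampedGraph a b V) ev) {m : ℕ} {x : Fin m → ℝ} (hx : ∀ j, x j ∈ Icc a b)
    {C : ℝ} (hC : ∀ D, IsW24 a b D → IsClamped a b D → (∀ j, D 0 (x j) = 0) →
      (∀ j, D 1 (x j) = 0) → C * (∫ t in a..b, ‖D 0 t‖ ^ 2) ≤
        (∫ t in a..b, ‖D 2 t‖ ^ 2) + ∫ t in a..b, V t * ‖D 0 t‖ ^ 2)
    {k : ℕ} (hk : 2 * m ≤ k) : C ≤ ev k := by
  obtain ⟨E, hE, hEk, hle⟩ := hev.exists_le k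
  have hfd : FiniteDimensional ℂ E := Module.finite_of_finrank_pos (by omega)
  let A : L2 a b × L2 a b →ₗ[ℂ] L2 a b :=
    LinearMap.snd ℂ _ _ - (potentialₗ hV).comp (LinearMap.fst ℂ _ _)
  -- Since `f - V u` is the fourth derivative of `u`, this map reads off value and slope of `u` at
  -- the `m` points: `2m` conditions on a space of dimension `k + 1 > 2m`.
  let L : E →ₗ[ℂ] (Fin m → ℂ × ℂ) := LinearMap.pi fun j =>
    (clampedEval hab (hx j)).comp (A.comp E.subtype)
  have hL : LinearMap.ker L ≠ ⊥ := by
    apply LinearMap.ker_ne_bot_of_finrank_lt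
    rw [hEk, Module.finrank_pi_fintype]
    simp only [Module.finrank_prod, Module.finrank_self, Finset.sum_const, Finset.card_univ,
      Fintype.card_fin, smul_eq_mul]
    omega
  obtain ⟨p, hp, hp0⟩ := Submodule.exists_mem_ne_zero_of_ne_bot hL
  obtain ⟨⟨u, f⟩, hpE⟩ := p
  have huf := (mem_clampedGraph_iff hab hV u f).1 (hE hpE)
  set h := f - potentialₗ hV u with hh
  have hz : ∀ j, clampedEval hab (hx j) h = 0 := fun j => congrFun (LinearMap.mem_ker.1 hp) j
  have hD := isW24_clampedSolution hab h
  have hcD := isClamped_clampedSolution hab h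
  have h1 := clampedInverse_ae hab h
  rw [huf] at h1
  have h2 : f =ᵐ[volume.restrict (Ioo a b)]
      fun x => clampedSolution hab h 4 x + (V x : ℂ) * clampedSolution hab h 0 x := by
    filter_upwards [Lp.coeFn_sub f (potentialₗ hV u), potentialₗ_ae hV u, h1,
      clampedSolution_fourth hab h] with x h2 h3 h4 h5
    rw [← h5, hh, h2, Pi.sub_apply, h3, ← h4]
    ring
  have h3 := hC _ hD hcD (fun j => congrArg Prod.fst (hz j)) (fun j => congrArg Prod.snd (hz j))
  have h4 := re_inner_clampedGraph hab.le hV (p := (u, f)) hD hcD h1 h2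
  rw [← h4, ← L2.norm_sq_eq hab.le h1] at h3
  have h5 : u ≠ 0 := fun h5 =>
    hp0 (Subtype.ext (Prod.ext h5 (clampedGraph_functional a b V _ (hE hpE) h5)))
  have h6 : 0 < ‖u‖ ^ 2 := by positivity
  exact le_of_mul_le_mul_right (h3.trans (hle _ hpE)) h6

end Potential

/-! ### Smooth test functions -/

section TestFunction

variable {a b : ℝ} {V : ℝ → ℝ} {φ : ℝ → ℝ}

/-- The derivatives of a smooth real function, as complex functions. -/
noncomputable def derivs (φ : ℝ → ℝ) (j : ℕ) (x : ℝ) : ℂ :=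
  ((iteratedDeriv j φ x : ℝ) : ℂ)

theorem isW24_derivs (hφ : ContDiff ℝ ∞ φ) : IsW24 a b (derivs φ) := by
  refine isW24_of_continuous (fun j _ x => ?_) fun j => ?_
  · have h1 : DifferentiableAt ℝ (iteratedDeriv j φ) x :=
      (hφ.differentiable_iteratedDeriv j (by exact_mod_cast WithTop.coe_lt_top _)) x
    have h2 := h1.hasDerivAt.ofReal_comp
    rwa [← iteratedDeriv_succ] at h2
  · exact Complex.continuous_ofReal.comp (hφ.continuous_iteratedDeriv j (by exact_mod_cast le_top))

theorem iteratedDeriv_eq_zero_of_notMem_tsupport {j : ℕ} {x : ℝ} (hx : x ∉ tsupport φ) :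
    iteratedDeriv j φ x = 0 := by
  have h1 : φ =ᶠ[𝓝 x] fun _ => 0 := notMem_tsupport_iff_eventuallyEq.1 hx
  rw [h1.iteratedDeriv_eq j]
  simp

theorem isClamped_derivs (hφ : tsupport φ ⊆ Ioo a b) : IsClamped a b (derivs φ) := by
  have ha : a ∉ tsupport φ := fun h => lt_irrefl a (hφ h).1
  have hb : b ∉ tsupport φ := fun h => lt_irrefl b (hφ h).2
  refine ⟨?_, ?_, ?_, ?_⟩ <;> simp [derivs, iteratedDeriv_eq_zero_of_notMem_tsupport, ha, hb]

theorem exists_mem_clampedGraph (hφ : ContDiff ℝ ∞ φ) (hs : tsupport φ ⊆ Ioo a b)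
    (hV : ContinuousOn V (Icc a b)) : ∃ p ∈ clampedGraph a b V,
      p.1 =ᵐ[volume.restrict (Ioo a b)] derivs φ 0 ∧
      p.2 =ᵐ[volume.restrict (Ioo a b)] fun x => derivs φ 4 x + (V x : ℂ) * derivs φ 0 x := by
  have hc : ∀ j, Continuous (derivs φ j) := fun j =>
    Complex.continuous_ofReal.comp (hφ.continuous_iteratedDeriv j (by exact_mod_cast le_top))
  have h0 : MemLp (derivs φ 0) 2 (volume.restrict (Ioo a b)) :=
    memLp_of_continuousOn (hc 0).continuousOn
  have h4 : MemLp (fun x => derivs φ 4 x + (V x : ℂ) * derivs φ 0 x) 2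
      (volume.restrict (Ioo a b)) :=
    memLp_of_continuousOn ((hc 4).continuousOn.add
      ((Complex.continuous_ofReal.comp_continuousOn hV).mul (hc 0).continuousOn))
  exact ⟨(h0.toLp _, h4.toLp _), ⟨_, isW24_derivs hφ, isClamped_derivs hs, h0.coeFn_toLp,
    h4.coeFn_toLp⟩, h0.coeFn_toLp, h4.coeFn_toLp⟩

theorem exists_bumps {c d : ℝ} (hcd : c < d) (n : ℕ) : ∃ (φ : Fin n → ℝ → ℝ) (x : Fin n → ℝ),
    (∀ i, ContDiff ℝ ∞ (φ i)) ∧ (∀ i, tsupport (φ i) ⊆ Ioo c d) ∧ (∀ i, x i ∈ Ioo c d) ∧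
      ∀ i j, φ i (x j) = if i = j then 1 else 0 := by
  -- Centres `h` apart, at distance at least `h` from both ends, leave room for disjoint bumps of
  -- radius `h / 2` inside `(c, d)`.
  set h : ℝ := (d - c) / (n + 1)
  have hh : 0 < h := by
    have : 0 < d - c := sub_pos.2 hcd
    positivity
  have hn : (n + 1) * h = d - c := by simp only [h]; field_simp
  let x : Fin n → ℝ := fun i => c + (i + 1) * h
  let f : ∀ i : Fin n, ContDiffBump (x i) := fun i => ⟨h / 3, h / 2, by positivity, by linarith⟩
  have hi : ∀ i : Fin n, h ≤ ((i : ℝ) + 1) * h ∧ ((i : ℝ) + 1) * h ≤ n * h := fun i => by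
    have h1 : ((i : ℝ) + 1) ≤ n := by exact_mod_cast i.2
    have h2 : (0 : ℝ) ≤ i := Nat.cast_nonneg _
    exact ⟨by nlinarith, by gcongr⟩
  refine ⟨fun i => f i, x, fun i => (f i).contDiff, fun i y hy => ?_, fun i => ?_, fun i j => ?_⟩
  · rw [(f i).tsupport_eq, Metric.mem_closedBall, Real.dist_eq, abs_le] at hy
    have := hi i
    simp only [f, x] at hy
    constructor <;> linarith
  · have := hi i
    simp only [x]
    constructor <;> linarith
  · split_ifs with hij
    · subst hij
      exact (f i).one_of_mem_closedBall (by simp [(f i).rIn_pos.le])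
    · refine (f i).zero_of_le_dist ?_
      have h1 : (1 : ℝ) ≤ |(j : ℝ) - i| := by
        have h2 : (1 : ℤ) ≤ |(j : ℤ) - i| := by
          refine Int.one_le_abs (sub_ne_zero.2 fun h => hij (Fin.ext ?_))
          exact_mod_cast h.symm
        exact_mod_cast h2
      rw [Real.dist_eq]
      have h3 : x j - x i = (j - i) * h := by simp only [x]; ring
      rw [h3, abs_mul, abs_of_pos hh]
      change h / 2 ≤ _
      nlinarith

theorem linearIndependent_of_bumps {n : ℕ} {φ : Fin n → ℝ → ℝ} {x : Fin n → ℝ}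
    (hφ : ∀ i, Continuous (φ i)) (hx : ∀ i, x i ∈ Ioo a b)
    (hδ : ∀ i j, φ i (x j) = if i = j then 1 else 0) {u : Fin n → L2 a b}
    (hu : ∀ i, u i =ᵐ[volume.restrict (Ioo a b)] derivs (φ i) 0) : LinearIndependent ℂ u := by
  rw [Fintype.linearIndependent_iff]
  intro g hg j
  have h1 : (∑ i, g i • u i : L2 a b) =ᵐ[volume.restrict (Ioo a b)]
      fun y => ∑ i, g i * (φ i y : ℂ) := by
    have h2 := Lp.coeFn_finsetSum (Finset.univ) (fun i => g i • u i)
    have h3 : ∀ᵐ y ∂(volume.restrict (Ioo a b)), ∀ i, (g i • u i : L2 a b) y = g i * (φ i y : ℂ) := by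
      rw [ae_all_iff]
      intro i
      filter_upwards [Lp.coeFn_smul (g i) (u i), hu i] with y h4 h5
      rw [h4, Pi.smul_apply, h5, smul_eq_mul, derivs, iteratedDeriv_zero]
    filter_upwards [h2, h3] with y h4 h5
    rw [h4, Finset.sum_apply]
    exact Finset.sum_congr rfl fun i _ => h5 i
  rw [hg] at h1
  have h2 : (fun y => ∑ i, g i * (φ i y : ℂ)) =ᵐ[volume.restrict (Ioo a b)] fun _ => 0 :=
    h1.symm.trans (Lp.coeFn_zero _ _ _)
  have h3 : EqOn (fun y => ∑ i, g i * (φ i y : ℂ)) (fun _ => 0) (Ioo a b) := by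
    refine Measure.eqOn_Ioo_of_ae_eq volume h2 (Continuous.continuousOn ?_) continuousOn_const
    exact continuous_finsetSum _ fun i _ =>
      continuous_const.mul (Complex.continuous_ofReal.comp (hφ i))
  have h4 := h3 (hx j)
  simpa [hδ, apply_ite] using h4

theorem not_finiteDimensional_L2 (hab : a < b) : ¬ FiniteDimensional ℂ (L2 a b) := by
  intro hfd
  obtain ⟨φ, x, h1, h2, h3, h4⟩ := exists_bumps hab (Module.finrank ℂ (L2 a b) + 1)
  have h5 : ∀ i, ∃ u : L2 a b, u =ᵐ[volume.restrict (Ioo a b)] derivs (φ i) 0 := fun i => by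
    obtain ⟨p, -, hp, -⟩ := exists_mem_clampedGraph (h1 i) (h2 i) (V := fun _ => 0)
      continuousOn_const
    exact ⟨p.1, hp⟩
  choose u hu using h5
  have h6 := (linearIndependent_of_bumps (fun i => (h1 i).continuous) h3 h4 hu).fintype_card_le_finrank
  rw [Fintype.card_fin] at h6
  omega

end TestFunction

/-! ### The singular potential -/

section Singular

variable {a b : ℝ} {U Ψ Φ Υ₁ Υ₂ : ℝ → ℝ} {α β γ₁ γ₂ : ℝ}

/-- The support is open, hence contained in the interior `(-1, 1)`; this covers the endpoints too.
-/
theorem IsShape.eq_zero {f : ℝ → ℝ} (hf : IsShape f) {y : ℝ} (hy : 1 ≤ |y|) : f y = 0 := by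
  by_contra h0
  have h1 : Function.support f ⊆ Ioo (-1) 1 := by
    rw [← interior_Icc]
    exact interior_maximal ((subset_tsupport f).trans hf.2)
      hf.1.continuous.isOpen_support
  have h2 := h1 (Function.mem_support.2 h0)
  exact absurd hy (not_le.2 (abs_lt.2 h2))

theorem IsShape.exists_bound {f : ℝ → ℝ} (hf : IsShape f) : ∃ C, 0 ≤ C ∧ ∀ y, |f y| ≤ C := by
  obtain ⟨C, h0, hC⟩ := norm_bound_of_continuousOn (a := -1) (b := 1) hf.1.continuous.continuousOn
  refine ⟨C, h0, fun y => ?_⟩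
  by_cases hy : y ∈ Icc (-1 : ℝ) 1
  · exact hC y hy
  · rw [hf.eq_zero, abs_zero]
    · exact h0
    · by_contra h
      exact hy (abs_le.1 (not_le.1 h).le)

theorem IsShape.neg {f : ℝ → ℝ} (hf : IsShape f) : IsShape (fun x => -f x) := by
  refine ⟨hf.1.neg, ?_⟩
  have : tsupport (fun x => -f x) = tsupport f := by
    unfold tsupport
    congr 1
    ext x; simp
  rw [this]; exact hf.2

theorem one_le_abs_div {ε x : ℝ} (hε : 0 < ε) (hx : ε ≤ |x|) : 1 ≤ |x / ε| := by
  rw [abs_div, abs_of_pos hε, le_div_iff₀ hε, one_mul]; exact hx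

theorem singularPotential_eq_zero (hΨ : IsShape Ψ) (hΦ : IsShape Φ) (h₁ : IsShape Υ₁)
    (h₂ : IsShape Υ₂) {ε x : ℝ} (hε : 0 < ε) (hx : ε ≤ |x|) :
    singularPotential α β γ₁ γ₂ Ψ Φ Υ₁ Υ₂ ε x = 0 := by
  have h := one_le_abs_div hε hx
  simp [singularPotential, hΨ.eq_zero h, hΦ.eq_zero h, h₁.eq_zero h, h₂.eq_zero h]

theorem div_pow_le_div_pow {ε γ : ℝ} (hε : 0 < ε) (h1 : ε < 1) {i j : ℕ} (hij : i ≤ j)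
    (hγ : 0 ≤ γ) : γ / ε ^ i ≤ γ / ε ^ j := by
  have : ε ^ j ≤ ε ^ i := pow_le_pow_of_le_one hε.le h1.le hij
  gcongr

theorem abs_div_pow_mul_le {f : ℝ → ℝ} {C γ ε x : ℝ} (hC : ∀ y, |f y| ≤ C) (hε : 0 < ε)
    (h1 : ε < 1) {i j : ℕ} (hij : i ≤ j) : |γ / ε ^ i * f (x / ε)| ≤ |γ| * C / ε ^ j := by
  rw [abs_mul, abs_div, abs_of_pos (pow_pos hε i)]
  calc |γ| / ε ^ i * |f (x / ε)| ≤ |γ| / ε ^ j * C :=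
        mul_le_mul (div_pow_le_div_pow hε h1 hij (abs_nonneg _)) (hC _) (abs_nonneg _)
          (by positivity)
    _ = _ := by ring

/-- The lower order terms are dominated by `ε⁻³`. -/
theorem exists_singularPotential_sub_le (hΦ : IsShape Φ) (h₁ : IsShape Υ₁) (h₂ : IsShape Υ₂) :
    ∃ M, 0 ≤ M ∧ ∀ ε ∈ Ioo (0 : ℝ) 1, ∀ x,
      |singularPotential α β γ₁ γ₂ Ψ Φ Υ₁ Υ₂ ε x - α / ε ^ 4 * Ψ (x / ε)| ≤ M / ε ^ 3 := by
  obtain ⟨A, hA0, hA⟩ := hΦ.exists_bound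
  obtain ⟨B, hB0, hB⟩ := h₁.exists_bound
  obtain ⟨C, hC0, hC⟩ := h₂.exists_bound
  refine ⟨|β| * A + |γ₁| * B + |γ₂| * C, by positivity, fun ε hε x => ?_⟩
  have t1 := abs_div_pow_mul_le (γ := β) (x := x) hA hε.1 hε.2 (le_refl 3)
  have t2 := abs_div_pow_mul_le (γ := γ₁) (x := x) hB hε.1 hε.2 (show 2 ≤ 3 by norm_num)
  have t3 := abs_div_pow_mul_le (γ := γ₂) (x := x) hC hε.1 hε.2 (show 1 ≤ 3 by norm_num)
  rw [pow_one] at t3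
  have h : singularPotential α β γ₁ γ₂ Ψ Φ Υ₁ Υ₂ ε x - α / ε ^ 4 * Ψ (x / ε) =
      β / ε ^ 3 * Φ (x / ε) + γ₁ / ε ^ 2 * Υ₁ (x / ε) + γ₂ / ε * Υ₂ (x / ε) := by
    unfold singularPotential; ring
  rw [h, add_div, add_div]
  exact (abs_add_three _ _ _).trans (add_le_add (add_le_add t1 t2) t3)

theorem exists_singularPotential_le (hΨ : IsShape Ψ) (hΦ : IsShape Φ) (h₁ : IsShape Υ₁)
    (h₂ : IsShape Υ₂) : ∃ M, 0 ≤ M ∧ ∀ ε ∈ Ioo (0 : ℝ) 1, ∀ x,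
      |singularPotential α β γ₁ γ₂ Ψ Φ Υ₁ Υ₂ ε x| ≤ M / ε ^ 4 := by
  obtain ⟨M, hM0, hM⟩ := exists_singularPotential_sub_le (α := α) (β := β) (γ₁ := γ₁) (γ₂ := γ₂)
    (Ψ := Ψ) hΦ h₁ h₂
  obtain ⟨A, hA0, hA⟩ := hΨ.exists_bound
  refine ⟨M + |α| * A, by positivity, fun ε hε x => ?_⟩
  have t1 := abs_div_pow_mul_le (γ := α) (x := x) hA hε.1 hε.2 (le_refl 4)
  have t2 := (hM ε hε x).trans (div_pow_le_div_pow hε.1 hε.2 (show 3 ≤ 4 by norm_num) hM0)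
  rw [add_div]
  calc |singularPotential α β γ₁ γ₂ Ψ Φ Υ₁ Υ₂ ε x| =
        |(singularPotential α β γ₁ γ₂ Ψ Φ Υ₁ Υ₂ ε x - α / ε ^ 4 * Ψ (x / ε)) +
          α / ε ^ 4 * Ψ (x / ε)| := by rw [sub_add_cancel]
    _ ≤ _ := (abs_add_le _ _).trans (add_le_add t2 t1)

theorem continuousOn_singularPotential (hΨ : IsShape Ψ) (hΦ : IsShape Φ) (h₁ : IsShape Υ₁)
    (h₂ : IsShape Υ₂) : ContinuousOn
      (Function.uncurry (singularPotential α β γ₁ γ₂ Ψ Φ Υ₁ Υ₂)) (Ioo 0 1 ×ˢ univ) := by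
  have hd : ∀ f : ℝ → ℝ, Continuous f → ∀ γ : ℝ, ∀ n : ℕ,
      ContinuousOn (fun p : ℝ × ℝ => γ / p.1 ^ n * f (p.2 / p.1)) (Ioo 0 1 ×ˢ univ) := by
    intro f hf γ n
    have hne : ∀ p ∈ (Ioo (0 : ℝ) 1 ×ˢ (univ : Set ℝ)), p.1 ≠ 0 := fun p hp => hp.1.1.ne'
    exact (continuousOn_const.div (continuousOn_fst.pow n) fun p hp => pow_ne_zero n (hne p hp)).mul
      (hf.comp_continuousOn (continuousOn_snd.div continuousOn_fst hne))
  have h1 := hd Υ₂ h₂.1.continuous γ₂ 1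
  simp only [pow_one] at h1
  exact (((hd Ψ hΨ.1.continuous α 4).add (hd Φ hΦ.1.continuous β 3)).add
    (hd Υ₁ h₁.1.continuous γ₁ 2)).add h1

theorem continuous_singularPotential (hΨ : IsShape Ψ) (hΦ : IsShape Φ) (h₁ : IsShape Υ₁)
    (h₂ : IsShape Υ₂) (ε : ℝ) : Continuous (singularPotential α β γ₁ γ₂ Ψ Φ Υ₁ Υ₂ ε) := by
  have hΨ' := hΨ.1.continuous
  have hΦ' := hΦ.1.continuous
  have h₁' := h₁.1.continuous
  have h₂' := h₂.1.continuous
  unfold singularPotential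
  fun_prop

/-! ### Lower bounds -/

/-- Only `[-ε, ε]` matters, and Poincaré on its grid has the constant `(2ε/m)⁴`. Against `M ε⁻⁴`
this leaves `16 M / m⁴ ≤ 1`, a condition free of `ε`. -/
theorem integral_singularPotential_ge (hΨ : IsShape Ψ) (hΦ : IsShape Φ) (h₁ : IsShape Υ₁)
    (h₂ : IsShape Υ₂) {M : ℝ} (hM0 : 0 ≤ M) {ε : ℝ} (hε : 0 < ε)
    (hM : ∀ x, |singularPotential α β γ₁ γ₂ Ψ Φ Υ₁ Υ₂ ε x| ≤ M / ε ^ 4)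
    (ha : a ≤ -ε) (hb : ε ≤ b) {m : ℕ} (hm : 0 < m) (hMm : 16 * M ≤ (m : ℝ) ^ 4) {D : ℕ → ℝ → ℂ}
    (hD : IsW24 a b D) (z₀ : ∀ j < m, D 0 (-ε + j * ((ε - -ε) / m)) = 0)
    (z₁ : ∀ j < m, D 1 (-ε + j * ((ε - -ε) / m)) = 0) :
    -(∫ t in a..b, ‖D 2 t‖ ^ 2) ≤
      ∫ t in a..b, singularPotential α β γ₁ γ₂ Ψ Φ Υ₁ Υ₂ ε t * ‖D 0 t‖ ^ 2 := by
  have hab : a ≤ b := by linarith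
  set S := singularPotential α β γ₁ γ₂ Ψ Φ Υ₁ Υ₂ ε
  have hSc : Continuous S := continuous_singularPotential hΨ hΦ h₁ h₂ ε
  have hc0 : ContinuousOn (fun t => ‖D 0 t‖ ^ 2) (Icc a b) :=
    (hD.continuousOn hab (by norm_num)).norm.pow 2
  have hc2 : ContinuousOn (fun t => ‖D 2 t‖ ^ 2) (Icc a b) :=
    (hD.continuousOn hab (by norm_num)).norm.pow 2
  have hcS : ContinuousOn (fun t => S t * ‖D 0 t‖ ^ 2) (Icc a b) := hSc.continuousOn.mul hc0
  have hi : ∀ f : ℝ → ℝ, ContinuousOn f (Icc a b) → ∀ p q, a ≤ p → p ≤ q → q ≤ b →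
      IntervalIntegrable f volume p q := fun f hf p q hp hpq hq =>
    (hf.mono (Icc_subset_Icc hp hq)).intervalIntegrable_of_Icc hpq
  have hz : ∀ p q, (∀ t ∈ uIcc p q, ε ≤ |t|) → ∫ t in p..q, S t * ‖D 0 t‖ ^ 2 = 0 := by
    intro p q hpq
    rw [← intervalIntegral.integral_zero (a := p) (b := q) (μ := volume)]
    refine intervalIntegral.integral_congr fun t ht => ?_
    simp only [S]
    rw [singularPotential_eq_zero hΨ hΦ h₁ h₂ hε (hpq t ht), zero_mul]
  have hsplit : ∫ t in a..b, S t * ‖D 0 t‖ ^ 2 = ∫ t in (-ε)..ε, S t * ‖D 0 t‖ ^ 2 := by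
    rw [← intervalIntegral.integral_add_adjacent_intervals
        (hi _ hcS a (-ε) le_rfl ha (by linarith)) (hi _ hcS (-ε) b ha (by linarith) le_rfl),
      ← intervalIntegral.integral_add_adjacent_intervals
        (hi _ hcS (-ε) ε ha (by linarith) hb) (hi _ hcS ε b (by linarith) hb le_rfl),
      hz a (-ε), hz ε b, zero_add, add_zero]
    · intro t ht
      rw [uIcc_of_le hb] at ht
      exact ht.1.trans (le_abs_self t)
    · intro t ht
      rw [uIcc_of_le ha] at ht
      exact (by linarith [ht.2] : ε ≤ -t).trans (neg_le_abs t)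
  rw [hsplit]
  have hP := integral_norm_sq_le_of_grid (hD.primitive 0 (by norm_num))
    (hD.primitive 1 (by norm_num)) (hD.continuousOn hab (by norm_num)) ha hb (by linarith) hm z₀ z₁
  set A := ∫ t in (-ε)..ε, ‖D 2 t‖ ^ 2
  have hA0 : 0 ≤ A := intervalIntegral.integral_nonneg (by linarith) fun t _ => by positivity
  have hAle : A ≤ ∫ t in a..b, ‖D 2 t‖ ^ 2 :=
    intervalIntegral.integral_mono_interval ha (by linarith) hb
      (Eventually.of_forall fun t => by positivity) (hi _ hc2 a b le_rfl hab le_rfl)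
  have hlow : -(M / ε ^ 4) * (∫ t in (-ε)..ε, ‖D 0 t‖ ^ 2) ≤ ∫ t in (-ε)..ε, S t * ‖D 0 t‖ ^ 2 := by
    rw [← intervalIntegral.integral_const_mul]
    refine intervalIntegral.integral_mono_on (by linarith)
      ((hi _ hc0 (-ε) ε ha (by linarith) hb).const_mul _) (hi _ hcS (-ε) ε ha (by linarith) hb)
      fun t _ => ?_
    have := (abs_le.1 (hM t)).1
    gcongr
  have hm' : (0 : ℝ) < m := by exact_mod_cast hm
  have hconst : M / ε ^ 4 * ((ε - -ε) / m) ^ 4 ≤ 1 := by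
    have : M / ε ^ 4 * ((ε - -ε) / m) ^ 4 = 16 * M / (m : ℝ) ^ 4 := by field_simp; ring
    rw [this, div_le_one (by positivity)]
    exact hMm
  have h5 : M / ε ^ 4 * (∫ t in (-ε)..ε, ‖D 0 t‖ ^ 2) ≤ A := by
    calc M / ε ^ 4 * (∫ t in (-ε)..ε, ‖D 0 t‖ ^ 2) ≤ M / ε ^ 4 * (((ε - -ε) / m) ^ 4 * A) := by
          gcongr
      _ = M / ε ^ 4 * ((ε - -ε) / m) ^ 4 * A := by ring
      _ ≤ 1 * A := by gcongr
      _ = A := one_mul A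
  linarith

/-- All but finitely many eigenvalues are bounded below. -/
theorem exists_lower_bound (ha : a < 0) (hb : 0 < b) (hU : ContinuousOn U (Icc a b))
    (hΨ : IsShape Ψ) (hΦ : IsShape Φ) (h₁ : IsShape Υ₁) (h₂ : IsShape Υ₂) {ev : ℕ → ℝ → ℝ}
    (hev : ∀ ε ∈ Ioo (0 : ℝ) 1, IsMinMax (clampedGraph a b fun x =>
      U x + singularPotential α β γ₁ γ₂ Ψ Φ Υ₁ Υ₂ ε x) (fun k => ev k ε)) :
    ∃ N : ℕ, ∀ k, N ≤ k → ∃ C : ℝ, ∀ᶠ ε in 𝓝[>] (0 : ℝ), C ≤ ev k ε := by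
  have hab : a < b := ha.trans hb
  obtain ⟨M, hM0, hM⟩ := exists_singularPotential_le (α := α) (β := β) (γ₁ := γ₁) (γ₂ := γ₂)
    hΨ hΦ h₁ h₂
  obtain ⟨CU, -, hCU⟩ := norm_bound_of_continuousOn hU
  -- Because `m ≥ 1`, `16 M ≤ m` already implies `16 M ≤ m⁴`.
  obtain ⟨m, hm⟩ := exists_nat_ge (max (16 * M) 1)
  have hm1 : (1 : ℝ) ≤ m := (le_max_right _ _).trans hm
  have hMm : 16 * M ≤ (m : ℝ) ^ 4 :=
    ((le_max_left _ _).trans hm).trans (le_self_pow₀ hm1 (by norm_num))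
  have hm0 : 0 < m := by exact_mod_cast (zero_lt_one.trans_le hm1)
  refine ⟨2 * m, fun k hk => ⟨-CU, ?_⟩⟩
  have hev0 : ∀ᶠ ε in 𝓝[>] (0 : ℝ), ε ∈ Ioo 0 (min 1 (min (-a) b)) :=
    Ioo_mem_nhdsGT (lt_min one_pos (lt_min (neg_pos.2 ha) hb))
  filter_upwards [hev0] with ε hε
  have hε1 : ε ∈ Ioo (0 : ℝ) 1 := ⟨hε.1, hε.2.trans_le (min_le_left _ _)⟩
  have hεa : ε < -a := hε.2.trans_le ((min_le_right _ _).trans (min_le_left _ _))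
  have hεb : ε < b := hε.2.trans_le ((min_le_right _ _).trans (min_le_right _ _))
  have hSc := continuous_singularPotential (α := α) (β := β) (γ₁ := γ₁) (γ₂ := γ₂) hΨ hΦ h₁ h₂ ε
  have hV : ContinuousOn (fun x => U x + singularPotential α β γ₁ γ₂ Ψ Φ Υ₁ Υ₂ ε x) (Icc a b) :=
    hU.add hSc.continuousOn
  refine (hev ε hε1).le_of_grid hab hV (m := m)
    (x := fun j => -ε + (j : ℕ) * ((ε - -ε) / m)) (fun j => ?_) ?_ hk
  · have := grid_mem_Icc (a := -ε) (b := ε) (by linarith [hε.1]) j.2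
    exact ⟨by linarith [this.1], by linarith [this.2]⟩
  · intro D hD _ z₀ z₁
    have h3 := integral_singularPotential_ge hΨ hΦ h₁ h₂ hM0 hε.1 (hM ε hε1) (by linarith) hεb.le
      hm0 hMm hD (fun j hj => z₀ ⟨j, hj⟩) (fun j hj => z₁ ⟨j, hj⟩)
    have hc0 : ContinuousOn (fun t => ‖D 0 t‖ ^ 2) (Icc a b) :=
      (hD.continuousOn hab.le (by norm_num)).norm.pow 2
    have h4 : -CU * (∫ t in a..b, ‖D 0 t‖ ^ 2) ≤ ∫ t in a..b, U t * ‖D 0 t‖ ^ 2 := by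
      rw [← intervalIntegral.integral_const_mul]
      refine intervalIntegral.integral_mono_on hab.le
        ((hc0.intervalIntegrable_of_Icc hab.le).const_mul _)
        ((hU.mul hc0).intervalIntegrable_of_Icc hab.le) fun t ht => ?_
      have := (abs_le.1 (hCU t ht)).1
      gcongr
    simp only [add_mul]
    have i1 : IntervalIntegrable (fun t => U t * ‖D 0 t‖ ^ 2) volume a b :=
      (hU.mul hc0).intervalIntegrable_of_Icc hab.le
    have i2 : IntervalIntegrable (fun t => singularPotential α β γ₁ γ₂ Ψ Φ Υ₁ Υ₂ ε t *
        ‖D 0 t‖ ^ 2) volume a b := (hSc.continuousOn.mul hc0).intervalIntegrable_of_Icc hab.le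
    rw [intervalIntegral.integral_add i1 i2]
    linarith

/-! ### Upper bounds and continuity -/

/-- Every eigenvalue is bounded above. -/
theorem exists_upper_bound (ha : a < 0) (hb : 0 < b) (hU : ContinuousOn U (Icc a b))
    (hΨ : IsShape Ψ) (hΦ : IsShape Φ) (h₁ : IsShape Υ₁) (h₂ : IsShape Υ₂) {ev : ℕ → ℝ → ℝ}
    (hev : ∀ ε ∈ Ioo (0 : ℝ) 1, IsMinMax (clampedGraph a b fun x =>
      U x + singularPotential α β γ₁ γ₂ Ψ Φ Υ₁ Υ₂ ε x) (fun k => ev k ε)) (k : ℕ) :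
    ∃ C : ℝ, ∀ᶠ ε in 𝓝[>] (0 : ℝ), ev k ε ≤ C := by
  -- The supports stay in `(b/2, b)`, away from the shrinking perturbation.
  obtain ⟨φ, x, hφ, hs, hx, hδ⟩ := exists_bumps (half_lt_self hb) (k + 1)
  have hsub : Ioo (b / 2) b ⊆ Ioo a b := Ioo_subset_Ioo_left (by linarith)
  choose p hp hp1 hp2 using fun i => exists_mem_clampedGraph (hφ i) ((hs i).trans hsub) hU
  have hli1 := linearIndependent_of_bumps (fun i => (hφ i).continuous) (fun i => hsub (hx i)) hδ hp1
  have hli : LinearIndependent ℂ p := LinearIndependent.of_comp (LinearMap.fst ℂ _ _) hli1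
  set E := Submodule.span ℂ (Set.range p)
  have hEk : Module.finrank ℂ E = k + 1 := by rw [finrank_span_eq_card hli, Fintype.card_fin]
  have hfd : FiniteDimensional ℂ E := Module.finite_of_finrank_pos (by omega)
  have hEU : E ≤ clampedGraph a b U := Submodule.span_le.2 (by rintro _ ⟨i, rfl⟩; exact hp i)
  let F : E →ₗ[ℂ] L2 a b := (LinearMap.fst ℂ _ _).comp E.subtype
  have hF : LinearMap.ker F = ⊥ := by
    rw [LinearMap.ker_eq_bot']
    intro q hq
    exact Subtype.ext (Prod.ext hq (clampedGraph_functional a b U _ (hEU q.2) hq))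
  -- On the finite-dimensional `E`, which does not depend on `ε`, injectivity of the first
  -- projection gives `‖q‖ ≤ K ‖q.1‖`; this `K` bounds the form.
  obtain ⟨K, -, hK⟩ := F.exists_antilipschitzWith hF
  refine ⟨K, ?_⟩
  have hev0 : ∀ᶠ ε in 𝓝[>] (0 : ℝ), ε ∈ Ioo 0 (min 1 (b / 2)) :=
    Ioo_mem_nhdsGT (lt_min one_pos (half_pos hb))
  filter_upwards [hev0] with ε hε
  have hε1 : ε ∈ Ioo (0 : ℝ) 1 := ⟨hε.1, hε.2.trans_le (min_le_left _ _)⟩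
  have hεb : ε < b / 2 := hε.2.trans_le (min_le_right _ _)
  refine (hev ε hε1).le_of_forall_le (clampedGraph_functional a b _) (E := E)
    (Submodule.span_le.2 ?_) hEk fun q hq => ?_
  · rintro _ ⟨i, rfl⟩
    refine ⟨derivs (φ i), isW24_derivs (hφ i), isClamped_derivs ((hs i).trans hsub), hp1 i, ?_⟩
    filter_upwards [hp2 i] with t ht
    rw [ht]
    by_cases hts : t ∈ tsupport (φ i)
    · have h3 := (hs i hts).1
      rw [singularPotential_eq_zero hΨ hΦ h₁ h₂ hε.1 ((by linarith : ε ≤ t).trans (le_abs_self t)),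
        add_zero]
    · rw [derivs, derivs, iteratedDeriv_eq_zero_of_notMem_tsupport hts (j := 0)]
      simp
  · have h3 : ‖q‖ ≤ K * ‖q.1‖ := by
      have := hK.le_mul_dist ⟨q, hq⟩ 0
      simpa [F] using this
    calc (inner ℂ q.2 q.1).re ≤ ‖inner ℂ q.2 q.1‖ := Complex.re_le_norm _
      _ ≤ ‖q.2‖ * ‖q.1‖ := norm_inner_le_norm _ _
      _ ≤ (K * ‖q.1‖) * ‖q.1‖ := by gcongr; exact (norm_snd_le q).trans h3
      _ = _ := by ring

/-- Joint continuity and compactness of `[a, b]` make the potential continuous in `ε` uniformly in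
`x`; `IsMinMax.le_add`, used in both directions, passes this to the eigenvalues. -/
theorem continuousOn_eigenvalue (hU : ContinuousOn U (Icc a b))
    (hΨ : IsShape Ψ) (hΦ : IsShape Φ) (h₁ : IsShape Υ₁) (h₂ : IsShape Υ₂) {ev : ℕ → ℝ → ℝ}
    (hev : ∀ ε ∈ Ioo (0 : ℝ) 1, IsMinMax (clampedGraph a b fun x =>
      U x + singularPotential α β γ₁ γ₂ Ψ Φ Υ₁ Υ₂ ε x) (fun k => ev k ε)) (k : ℕ) :
    ContinuousOn (ev k) (Ioo 0 1) := by
  intro ε₀ hε₀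
  rw [ContinuousWithinAt, Metric.tendsto_nhds]
  intro δ hδ
  obtain ⟨v, hv, hvu⟩ := isCompact_Icc.mem_uniformity_of_prod (k := Icc a b)
    ((continuousOn_singularPotential (α := α) (β := β) (γ₁ := γ₁) (γ₂ := γ₂) hΨ hΦ h₁ h₂).mono
      (prod_mono_right (subset_univ _))) hε₀ (Metric.dist_mem_uniformity (half_pos hδ))
  have hVc : ∀ ε, ContinuousOn (fun x => U x + singularPotential α β γ₁ γ₂ Ψ Φ Υ₁ Υ₂ ε x)
      (Icc a b) := fun ε => hU.add (continuous_singularPotential hΨ hΦ h₁ h₂ ε).continuousOn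
  filter_upwards [hv, self_mem_nhdsWithin] with ε hε hε1
  have h3 : ∀ x ∈ Icc a b, |singularPotential α β γ₁ γ₂ Ψ Φ Υ₁ Υ₂ ε x -
      singularPotential α β γ₁ γ₂ Ψ Φ Υ₁ Υ₂ ε₀ x| ≤ δ / 2 := fun x hx => (hvu ε hε x hx).le
  have h4 := IsMinMax.le_add (hVc ε) (hVc ε₀) (δ := δ / 2)
    (fun x hx => by rw [add_sub_add_left_eq_sub]; exact h3 x hx) (hev ε hε1) (hev ε₀ hε₀) k
  have h5 := IsMinMax.le_add (hVc ε₀) (hVc ε) (δ := δ / 2)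
    (fun x hx => by rw [add_sub_add_left_eq_sub, abs_sub_comm]; exact h3 x hx)
    (hev ε₀ hε₀) (hev ε hε1) k
  rw [Real.dist_eq, abs_lt]
  constructor <;> linarith

/-! ### The ground state -/

theorem integral_scaled {g : ℝ → ℝ} {R ε : ℝ} (hg : Function.support g ⊆ Icc (-R) R) (hε : 0 < ε)
    (ha : a < -(ε * R)) (hb : ε * R < b) : ∫ x in a..b, g (x / ε) = ε * ∫ y, g y := by
  rw [intervalIntegral.integral_eq_integral_of_support_subset, Measure.integral_comp_div,
    abs_of_pos hε, smul_eq_mul]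
  intro x hx
  have h1 := hg (show x / ε ∈ Function.support g from hx)
  rw [mem_Icc, le_div_iff₀ hε, div_le_iff₀ hε] at h1
  constructor <;> nlinarith [h1.1, h1.2]

/-- The rescaled function `φ(x/ε)` has Rayleigh quotient at most `ε⁻⁴ (A + α B) / N + (M + CU) ε⁻³`:
`U` and the weaker singular terms are of lower order. -/
theorem exists_ground_state_le (ha : a < 0) (hb : 0 < b) (hU : ContinuousOn U (Icc a b))
    (hΨ : IsShape Ψ) (hΦ : IsShape Φ) (h₁ : IsShape Υ₁) (h₂ : IsShape Υ₂) {ev : ℕ → ℝ → ℝ}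
    (hev : ∀ ε ∈ Ioo (0 : ℝ) 1, IsMinMax (clampedGraph a b fun x =>
      U x + singularPotential α β γ₁ γ₂ Ψ Φ Υ₁ Υ₂ ε x) (fun k => ev k ε))
    {φ : ℝ → ℝ} (hφ : ContDiff ℝ ∞ φ) (hs : HasCompactSupport φ)
    (hneg : (∫ y, iteratedDeriv 2 φ y ^ 2) + α * ∫ y, Ψ y * φ y ^ 2 < 0) :
    ∃ c : ℝ, 0 < c ∧ ∀ᶠ ε in 𝓝[>] (0 : ℝ), ev 0 ε ≤ -c / ε ^ 4 := by
  have hab : a < b := ha.trans hb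
  obtain ⟨M, hM0, hM⟩ := exists_singularPotential_sub_le (α := α) (β := β) (γ₁ := γ₁) (γ₂ := γ₂)
    (Ψ := Ψ) hΦ h₁ h₂
  obtain ⟨CU, hCU0, hCU⟩ := norm_bound_of_continuousOn hU
  obtain ⟨R, hR⟩ : ∃ R, tsupport φ ⊆ Icc (-R) R := by
    obtain ⟨R, hR⟩ := hs.isCompact.isBounded.subset_closedBall (0 : ℝ)
    exact ⟨R, by rwa [Real.closedBall_eq_Icc, zero_sub, zero_add] at hR⟩
  have hφc : ∀ j, Continuous (iteratedDeriv j φ) := fun j =>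
    hφ.continuous_iteratedDeriv j (by exact_mod_cast le_top)
  have hφc0 : Continuous φ := hφ.continuous
  have hΨc := hΨ.1.continuous
  have hcs : ∀ f : ℝ → ℝ, (∀ y, y ∉ tsupport φ → f y = 0) → HasCompactSupport f := fun f hf =>
    HasCompactSupport.intro hs.isCompact hf
  have hv0 : ∀ y, y ∉ tsupport φ → φ y = 0 := fun y hy => image_eq_zero_of_notMem_tsupport hy
  have hv2 : ∀ y, y ∉ tsupport φ → iteratedDeriv 2 φ y = 0 := fun y hy =>
    iteratedDeriv_eq_zero_of_notMem_tsupport hy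
  have hi2 : Integrable fun y => iteratedDeriv 2 φ y ^ 2 :=
    ((hφc 2).pow 2).integrable_of_hasCompactSupport (hcs _ fun y hy => by simp [hv2 y hy])
  have hi0 : Integrable fun y => φ y ^ 2 :=
    (hφc0.pow 2).integrable_of_hasCompactSupport (hcs _ fun y hy => by simp [hv0 y hy])
  have hiΨ : Integrable fun y => Ψ y * φ y ^ 2 :=
    (hΨc.mul (hφc0.pow 2)).integrable_of_hasCompactSupport (hcs _ fun y hy => by simp [hv0 y hy])
  set A := ∫ y, iteratedDeriv 2 φ y ^ 2
  set B := ∫ y, Ψ y * φ y ^ 2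
  set N := ∫ y, φ y ^ 2
  have hA0 : 0 ≤ A := integral_nonneg fun y => sq_nonneg _
  have hN : 0 < N := by
    -- Since `A ≥ 0`, the strict inequality rules out `B = 0`, and hence `φ = 0`.
    have hB : B ≠ 0 := by rintro h; rw [h, mul_zero, add_zero] at hneg; linarith
    obtain ⟨y, hy⟩ : ∃ y, φ y ≠ 0 := by
      by_contra! h
      exact hB (by simp [B, h])
    exact (hφc0.pow 2).integral_pos_of_hasCompactSupport_nonneg_nonzero
      (hcs _ fun y hy => by simp [hv0 y hy]) (fun y => sq_nonneg _) (pow_ne_zero 2 hy)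
  -- Half of the leading coefficient is kept as `c`; the other half absorbs the `ε⁻³` error once `(M
  -- + CU) ε ≤ c`.
  set c := -(A + α * B) / (2 * N)
  have hc : 0 < c := div_pos (by linarith) (by positivity)
  have hcN : A + α * B = -(2 * c * N) := by simp only [c]; field_simp
  refine ⟨c, hc, ?_⟩
  -- The radius `R` is not known to be positive.
  have hR1 : 0 < |R| + 1 := by positivity
  have hM1 : 0 < M + CU + 1 := by positivity
  have hev0 : ∀ᶠ ε in 𝓝[>] (0 : ℝ),
      ε ∈ Ioo 0 (min (min 1 (c / (M + CU + 1))) (min (-a / (|R| + 1)) (b / (|R| + 1)))) :=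
    Ioo_mem_nhdsGT (lt_min (lt_min one_pos (div_pos hc hM1))
      (lt_min (div_pos (neg_pos.2 ha) hR1) (div_pos hb hR1)))
  filter_upwards [hev0] with ε hε
  have hε0 : 0 < ε := hε.1
  obtain ⟨hh1, hh2⟩ := lt_min_iff.1 hε.2
  obtain ⟨hε1, hεc⟩ := lt_min_iff.1 hh1
  obtain ⟨hεa, hεb⟩ := lt_min_iff.1 hh2
  rw [lt_div_iff₀ hM1] at hεc
  rw [lt_div_iff₀ hR1] at hεa hεb
  have hRR : ε * R ≤ ε * (|R| + 1) := by gcongr; linarith [le_abs_self R]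
  have ha' : a < -(ε * R) := by linarith
  have hb' : ε * R < b := by linarith
  set ψ : ℝ → ℝ := fun x => φ (ε⁻¹ * x)
  have hψ : ContDiff ℝ ∞ ψ := hφ.comp (contDiff_const.mul contDiff_id)
  have hψs : tsupport ψ ⊆ Ioo a b := by
    have h3 : tsupport ψ ⊆ Icc (-(ε * R)) (ε * R) := by
      refine closure_minimal (fun x hx => ?_) isClosed_Icc
      have h4 := hR (subset_tsupport φ (show ε⁻¹ * x ∈ Function.support φ from hx))
      rw [mem_Icc, ← div_eq_inv_mul, le_div_iff₀ hε0, div_le_iff₀ hε0] at h4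
      constructor <;> nlinarith [h4.1, h4.2]
    exact h3.trans (Icc_subset_Ioo ha' hb')
  set S := singularPotential α β γ₁ γ₂ Ψ Φ Υ₁ Υ₂ ε
  have hSc : Continuous S := continuous_singularPotential hΨ hΦ h₁ h₂ ε
  have hV : ContinuousOn (fun x => U x + S x) (Icc a b) := hU.add hSc.continuousOn
  obtain ⟨p, hp, hp1, hp2⟩ := exists_mem_clampedGraph hψ hψs hV
  have hd0 : ∀ x, ‖derivs ψ 0 x‖ ^ 2 = φ (x / ε) ^ 2 := fun x => by
    rw [derivs, Complex.norm_real, iteratedDeriv_zero, Real.norm_eq_abs, sq_abs, div_eq_inv_mul]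
  have hd2 : ∀ x, ‖derivs ψ 2 x‖ ^ 2 = 1 / ε ^ 4 * iteratedDeriv 2 φ (x / ε) ^ 2 := fun x => by
    have h3 := iteratedDeriv_comp_const_mul (n := 2) (contDiff_infty.1 hφ 2) ε⁻¹
    rw [derivs, Complex.norm_real, Real.norm_eq_abs, sq_abs]
    simp only [ψ]
    rw [h3, div_eq_inv_mul x]
    simp only [mul_pow]
    field_simp
  have hnorm : ‖p.1‖ ^ 2 = ε * N := by
    rw [L2.norm_sq_eq hab.le hp1]
    simp only [hd0]
    refine integral_scaled (g := fun y => φ y ^ 2) (R := R) (fun y hy => ?_) hε0 ha' hb'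
    by_contra h
    exact hy (by simp [hv0 y fun h' => h (hR h')])
  have hquad : (inner ℂ p.2 p.1).re ≤ ε * (1 / ε ^ 4 * (A + α * B) + (M + CU) / ε ^ 3 * N) := by
    rw [re_inner_clampedGraph hab.le hV (isW24_derivs hψ) (isClamped_derivs hψs) hp1 hp2]
    set g : ℝ → ℝ := fun y => 1 / ε ^ 4 * (iteratedDeriv 2 φ y ^ 2 + α * (Ψ y * φ y ^ 2)) +
      (M + CU) / ε ^ 3 * φ y ^ 2
    have hg : ∫ y, g y = 1 / ε ^ 4 * (A + α * B) + (M + CU) / ε ^ 3 * N := by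
      have i1 : Integrable fun y => iteratedDeriv 2 φ y ^ 2 + α * (Ψ y * φ y ^ 2) :=
        hi2.add (hiΨ.const_mul α)
      simp only [g]
      rw [integral_add (i1.const_mul _) (hi0.const_mul _),
        integral_const_mul, integral_const_mul, integral_add hi2 (hiΨ.const_mul α),
        integral_const_mul]
    rw [← hg, ← integral_scaled (R := R) (fun y hy => ?_) hε0 ha' hb']
    · have hcd : ∀ j, Continuous fun x => ‖derivs ψ j x‖ ^ 2 := fun j =>
        (Complex.continuous_ofReal.comp
          (hψ.continuous_iteratedDeriv j (by exact_mod_cast le_top))).norm.pow 2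
      have hi1 : IntervalIntegrable (fun x => (U x + S x) * ‖derivs ψ 0 x‖ ^ 2) volume a b :=
        (hV.mul (hcd 0).continuousOn).intervalIntegrable_of_Icc hab.le
      have hgc : Continuous g := by
        have := hφc 2
        simp only [g]
        fun_prop
      rw [← intervalIntegral.integral_add ((hcd 2).intervalIntegrable _ _) hi1]
      refine intervalIntegral.integral_mono_on hab.le (((hcd 2).intervalIntegrable _ _).add hi1)
        ((hgc.comp (continuous_id.div_const ε)).intervalIntegrable _ _) fun x hx => ?_
      rw [hd0, hd2]
      simp only [g]
      have h3 : U x ≤ CU / ε ^ 3 := by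
        have h4 := div_pow_le_div_pow hε0 hε1 (Nat.zero_le 3) hCU0
        rw [pow_zero, div_one] at h4
        exact ((abs_le.1 (hCU x hx)).2).trans h4
      have h5 : S x ≤ α / ε ^ 4 * Ψ (x / ε) + M / ε ^ 3 := by
        have := (abs_le.1 (hM ε ⟨hε0, hε1⟩ x)).2
        linarith
      have h6 : (U x + S x) * φ (x / ε) ^ 2 ≤
          (CU / ε ^ 3 + (α / ε ^ 4 * Ψ (x / ε) + M / ε ^ 3)) * φ (x / ε) ^ 2 := by gcongr
      calc _ ≤ 1 / ε ^ 4 * iteratedDeriv 2 φ (x / ε) ^ 2 +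
            (CU / ε ^ 3 + (α / ε ^ 4 * Ψ (x / ε) + M / ε ^ 3)) * φ (x / ε) ^ 2 := by gcongr
        _ = _ := by ring
    · by_contra h
      have h' : y ∉ tsupport φ := fun h' => h (hR h')
      exact hy (by simp [g, hv0 y h', hv2 y h'])
  have hp0 : p ≠ 0 := by
    rintro rfl
    have : 0 < ε * N := by positivity
    rw [← hnorm] at this
    simp at this
  have hle : (inner ℂ p.2 p.1).re ≤ -c / ε ^ 4 * ‖p.1‖ ^ 2 := by
    refine hquad.trans ?_
    rw [hnorm, hcN]
    have h3 : (M + CU) / ε ^ 3 ≤ c / ε ^ 4 := by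
      rw [div_le_div_iff₀ (by positivity) (by positivity)]
      have : (M + CU) * ε ≤ c := by nlinarith
      calc (M + CU) * ε ^ 4 = (M + CU) * ε * ε ^ 3 := by ring
        _ ≤ c * ε ^ 3 := by gcongr
    calc ε * (1 / ε ^ 4 * -(2 * c * N) + (M + CU) / ε ^ 3 * N) ≤
          ε * (1 / ε ^ 4 * -(2 * c * N) + c / ε ^ 4 * N) := by gcongr
      _ = _ := by ring
  refine (hev ε ⟨hε0, hε1⟩).le_of_forall_le (clampedGraph_functional a b _)
    (E := Submodule.span ℂ {p}) ?_ ?_ ?_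
  · rw [Submodule.span_singleton_le_iff_mem]; exact hp
  · rw [finrank_span_singleton hp0]
  · intro q hq
    obtain ⟨z, rfl⟩ := Submodule.mem_span_singleton.1 hq
    rw [Prod.smul_fst, Prod.smul_snd, inner_smul_left, inner_smul_right, ← mul_assoc,
      ← Complex.normSq_eq_conj_mul_self, Complex.re_ofReal_mul, norm_smul, mul_pow,
      Complex.normSq_eq_norm_sq]
    calc ‖z‖ ^ 2 * (inner ℂ p.2 p.1).re ≤ ‖z‖ ^ 2 * (-c / ε ^ 4 * ‖p.1‖ ^ 2) := by gcongr
      _ = _ := by ring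

/-- A test function for a coupling constant above a threshold that depends on the shape only. -/
theorem exists_threshold (hΨ : IsShape Ψ) (hneg : ∃ x, Ψ x < 0) :
    ∃ (r : ℝ) (φ : ℝ → ℝ), 0 < r ∧ ContDiff ℝ ∞ φ ∧ HasCompactSupport φ ∧
      ∀ α, r < α → (∫ y, iteratedDeriv 2 φ y ^ 2) + α * ∫ y, Ψ y * φ y ^ 2 < 0 := by
  obtain ⟨x, hx⟩ := hneg
  have hΨc := hΨ.1.continuous
  obtain ⟨δ, hδ, hball⟩ := Metric.isOpen_iff.1 (hΨc.isOpen_preimage _ isOpen_Iio) x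
    (show x ∈ Ψ ⁻¹' Iio 0 from hx)
  let φ : ContDiffBump x := ⟨δ / 2, δ, by positivity, by linarith⟩
  have hφ : ContDiff ℝ ∞ φ := φ.contDiff
  have hpos : 0 < ∫ y, -Ψ y * φ y ^ 2 := by
    refine Continuous.integral_pos_of_hasCompactSupport_nonneg_nonzero (x := x)
      (hΨc.neg.mul (φ.continuous.pow 2))
      (HasCompactSupport.intro φ.hasCompactSupport.isCompact fun y hy => ?_) (fun y => ?_) ?_
    · simp [image_eq_zero_of_notMem_tsupport hy]
    · by_cases hy : y ∈ Metric.ball x δ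
      · have : Ψ y < 0 := hball hy
        exact mul_nonneg (by linarith) (sq_nonneg _)
      · have : φ y = 0 := φ.zero_of_le_dist (not_lt.1 hy)
        simp [this]
    · have : φ x = 1 := φ.one_of_mem_closedBall (Metric.mem_closedBall_self (by positivity))
      simp [this, hx.ne]
  simp only [neg_mul, integral_neg] at hpos
  set B := ∫ y, Ψ y * φ y ^ 2
  set A := ∫ y, iteratedDeriv 2 φ y ^ 2
  have hA : 0 ≤ A := integral_nonneg fun y => sq_nonneg _
  -- The sum is negative exactly when `α > A / -B`, as `B < 0`; the added `1` makes the threshold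
  -- positive without proving `A > 0`.
  refine ⟨A / -B + 1, φ, by positivity, hφ, φ.hasCompactSupport, fun α hα => ?_⟩
  have h1 : A / -B < α := by linarith
  rw [div_lt_iff₀ hpos] at h1
  linarith

theorem eventually_neg_div_pow_lt {c : ℝ} (hc : 0 < c) (M : ℝ) :
    ∀ᶠ ε in 𝓝[>] (0 : ℝ), -c / ε ^ 4 < M := by
  have hM : 0 < |M| + 1 := by positivity
  have h : ∀ᶠ ε in 𝓝[>] (0 : ℝ), ε ∈ Ioo 0 (min 1 (c / (|M| + 1))) :=
    Ioo_mem_nhdsGT (lt_min one_pos (div_pos hc hM))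
  filter_upwards [h] with ε hε
  obtain ⟨h1, h2⟩ := lt_min_iff.1 hε.2
  have h3 := div_pow_le_div_pow hε.1 h1 (show 1 ≤ 4 by norm_num) hc.le
  rw [pow_one] at h3
  have h4 : |M| + 1 < c / ε := by
    rw [lt_div_iff₀ hε.1]
    rw [lt_div_iff₀ hM] at h2
    linarith
  rw [neg_div]
  linarith [neg_abs_le M]

end Singular

/-! ### The eigenvalue theorem -/

/-- `ev k ε` is the `(k + 1)`-st eigenvalue of `S_ε`; the threshold `r` depends on `Ψ` only. -/
theorem theorem1 (Ψ : ℝ → ℝ) (hΨ : IsShape Ψ) :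
    ∃ r : ℝ, 0 < r ∧
      ∀ (a b : ℝ), a < 0 → 0 < b →
      ∀ (U : ℝ → ℝ), ContDiffOn ℝ ∞ U (Icc a b) →
      ∀ (Φ Υ₁ Υ₂ : ℝ → ℝ), IsShape Φ → IsShape Υ₁ → IsShape Υ₂ →
      ∀ (α β γ₁ γ₂ : ℝ),
      ∃ ev : ℕ → ℝ → ℝ,
        (∀ ε ∈ Ioo (0 : ℝ) 1,
          EnumeratesEigenvalues (singularOperator a b U α β γ₁ γ₂ Ψ Φ Υ₁ Υ₂ ε)
            (fun k => ev k ε)) ∧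
        (∀ k, ContinuousOn (ev k) (Ioo 0 1)) ∧
        (∀ k, ∃ C : ℝ, ∀ᶠ ε in 𝓝[>] (0 : ℝ), ev k ε ≤ C) ∧
        (ChangesSign Ψ → r < |α| →
          (∃ c : ℝ, 0 < c ∧ ∀ᶠ ε in 𝓝[>] (0 : ℝ), ev 0 ε ≤ -c / ε ^ 4) ∧
          (∀ M : ℝ, ∀ᶠ ε in 𝓝[>] (0 : ℝ), ∃ μ : ℝ, μ < M ∧
            (μ : ℂ) ∈ opSpectrum (singularOperator a b U α β γ₁ γ₂ Ψ Φ Υ₁ Υ₂ ε))) ∧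
        {k : ℕ | Tendsto (ev k) (𝓝[>] 0) atBot}.Finite ∧
        (∃ N : ℕ, ∀ k, N ≤ k → ∃ C : ℝ, ∀ᶠ ε in 𝓝[>] (0 : ℝ), C ≤ ev k ε) := by
  -- For negative `α` the threshold lemma is applied to `-Ψ`, which is negative somewhere because
  -- `Ψ` is positive somewhere. If `Ψ` does not change sign, nothing is required and `r = 1` is a
  -- default.
  obtain ⟨r, hr, hφ⟩ : ∃ r : ℝ, 0 < r ∧ (ChangesSign Ψ → ∀ α, r < |α| → ∃ φ : ℝ → ℝ,
      ContDiff ℝ ∞ φ ∧ HasCompactSupport φ ∧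
        (∫ y, iteratedDeriv 2 φ y ^ 2) + α * ∫ y, Ψ y * φ y ^ 2 < 0) := by
    by_cases hch : ChangesSign Ψ
    · obtain ⟨r₁, φ₁, hr₁, hs₁, hc₁, hn₁⟩ := exists_threshold hΨ hch.2
      obtain ⟨r₂, φ₂, hr₂, hs₂, hc₂, hn₂⟩ := exists_threshold hΨ.neg
        (hch.1.imp fun x hx => neg_neg_of_pos hx)
      refine ⟨max r₁ r₂, lt_max_of_lt_left hr₁, fun _ α hα => ?_⟩
      rcases le_total 0 α with h | h
      · rw [abs_of_nonneg h] at hα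
        exact ⟨φ₁, hs₁, hc₁, hn₁ α ((le_max_left _ _).trans_lt hα)⟩
      · rw [abs_of_nonpos h] at hα
        have h3 := hn₂ (-α) ((le_max_right _ _).trans_lt hα)
        simp only [neg_mul, integral_neg, mul_neg, neg_neg] at h3
        exact ⟨φ₂, hs₂, hc₂, h3⟩
    · exact ⟨1, one_pos, fun h => absurd h hch⟩
  refine ⟨r, hr, fun a b ha hb U hU Φ Υ₁ Υ₂ hΦ h₁ h₂ α β γ₁ γ₂ => ?_⟩
  have hab : a < b := ha.trans hb
  have hUc := hU.continuousOn
  -- The potential is continuous in `x` for every real `ε`, so the eigenvalues can be chosen for all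
  -- `ε`; only those in `(0, 1)` are used.
  choose lam hen hmm using fun ε => exists_enumeratesEigenvalues_clampedOperator hab
    (not_finiteDimensional_L2 hab) (V := fun x => U x + singularPotential α β γ₁ γ₂ Ψ Φ Υ₁ Υ₂ ε x)
    (hUc.add (continuous_singularPotential hΨ hΦ h₁ h₂ ε).continuousOn)
  set ev : ℕ → ℝ → ℝ := fun k ε => lam ε k
  have hev : ∀ ε ∈ Ioo (0 : ℝ) 1, IsMinMax (clampedGraph a b fun x =>
      U x + singularPotential α β γ₁ γ₂ Ψ Φ Υ₁ Υ₂ ε x) (fun k => ev k ε) := fun ε _ => hmm ε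
  obtain ⟨N, hN⟩ := exists_lower_bound ha hb hUc hΨ hΦ h₁ h₂ hev
  refine ⟨ev, fun ε _ => hen ε, continuousOn_eigenvalue hUc hΨ hΦ h₁ h₂ hev,
    exists_upper_bound ha hb hUc hΨ hΦ h₁ h₂ hev, fun hch hα => ?_, ?_, N, hN⟩
  · obtain ⟨φ, hφ1, hφ2, hφ3⟩ := hφ hch α hα
    obtain ⟨c, hc, hle⟩ := exists_ground_state_le ha hb hUc hΨ hΦ h₁ h₂ hev hφ1 hφ2 hφ3
    refine ⟨⟨c, hc, hle⟩, fun M => ?_⟩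
    filter_upwards [hle, eventually_neg_div_pow_lt hc M] with ε h3 h4
    refine ⟨ev 0 ε, h3.trans_lt h4, ?_⟩
    have h5 := (hen ε).spectrum_eq
    change _ ∈ opSpectrum (clampedOperator a b _)
    rw [h5]
    exact ⟨0, rfl⟩
  · refine (Set.finite_lt_nat N).subset fun k hk => ?_
    by_contra hkN
    obtain ⟨C, hC⟩ := hN k (not_lt.1 hkN)
    have h3 : ∀ᶠ ε in 𝓝[>] (0 : ℝ), ev k ε < C := hk.eventually_lt_atBot C
    obtain ⟨ε, h4, h5⟩ := (hC.and h3).exists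
    exact absurd h5 (not_lt.2 h4)
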